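/- Let $E=(E_1,\dots,E_N)$ be a tuple of positive real numbers, let $e_1,\dots,e_d$ be its distinct entries and $r_1,\dots,r_d$ their multiplicities, so that $N=r_1+\dots+r_d$. For $\lambda\in\mathbb{C}$ and $\varepsilon,\varrho\in\mathbb{C}^d$ with $\varepsilon_k+\varepsilon_l\neq 0$ for all $k,l$, put $$R(z)=z-\frac{\lambda}{N}\sum_{j=1}^d\frac{\varrho_j}{\varepsilon_j+z},$$ and consider the system $$e_k=R(\varepsilon_k),\qquad r_k=\varrho_k R'(\varepsilon_k)\qquad (k=1,\dots,d).\tag{S}$$ (a) There is $\delta>0$ such that on the disc $|\lambda|<\delta$ the system (S) has an implicitly defined solution $(\varepsilon(\lambda),\varrho(\lambda))$: it is holomorphic in $\lambda$, tends to $(e,r)$ for $\lambda\to0$, is the only solution of (S) in a suitable neighbourhood of $(e,r)$, and is real and positive for real $\lambda$. (b) Let either $0<|\lambda|<\delta$ and $(\varepsilon,\varrho)=(\varepsilon(\lambda),\varrho(\lambda))$, or let $\lambda>0$ be arbitrary and $(\varepsilon,\varrho)$ any solution of (S) with all $\varepsilon_k,\varrho_k>0$. Then for each $k$ the equation $R(z)=R(\varepsilon_k)$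 has exactly $d+1$ different roots $\varepsilon_k,\widehat{\varepsilon_k}^1,\dots,\widehat{\varepsilon_k}^d$. Put $$\mathcal{G}_{kl}=\frac{\Big(\prod_{j,m=1}^d\frac{-\widehat{\varepsilon_k}^j-\widehat{\varepsilon_l}^m}{\varepsilon_j+\varepsilon_m}\Big)\Big(\prod_{j\neq k}\frac{\varepsilon_k-\varepsilon_j}{R(\varepsilon_k)-R(\varepsilon_j)}\Big)\Big(\prod_{m\neq l}\frac{\varepsilon_l-\varepsilon_m}{R(\varepsilon_l)-R(\varepsilon_m)}\Big)}{R'(\varepsilon_k)R'(\varepsilon_l)(\varepsilon_k+\varepsilon_l)}$$ and let $\mathcal{G}^{(0)}$ be the rational function $$\mathcal{G}^{(0)}(z,w)=\frac{1}{(R(w)-R(-z))(R(z)-R(-w))}\Big\{R(z)+R(w)+\frac{\lambda}{N}\sum_{k=1}^d\Big(\frac{r_k}{R(\varepsilon_k)-R(z)}+\frac{r_k}{R(\varepsilon_k)-R(w)}\Big)+\frac{\lambda^2}{N^2}\sum_{k,l=1}^d\frac{r_kr_l\,\mathcal{G}_{kl}}{(R(\varepsilon_k)-R(z))(R(\varepsilon_l)-R(w))}\Big\},$$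 extended by continuity across removable singularities. Then $\mathcal{G}^{(0)}(\varepsilon_k,\varepsilon_l)=\mathcal{G}_{kl}$, and there are connected open neighbourhoods $\mathcal{U}_k\subset\mathbb{C}$ of $e_k$ and a holomorphic branch $R^{-1}$ of the inverse of $R$ on $\mathcal{U}=\bigcup_k\mathcal{U}_k$ with $R^{-1}(e_k)=\varepsilon_k$ such that $\mathcal{G}^{(0)}$ is regular at all points of $R^{-1}(\mathcal{U})\times R^{-1}(\mathcal{U})$, the function $G^{(0)}(\zeta,\eta)=\mathcal{G}^{(0)}(R^{-1}(\zeta),R^{-1}(\eta))$ is holomorphic on $\mathcal{U}\times\mathcal{U}$, and for all $\zeta,\eta\in\mathcal{U}$ $$\Big(\zeta+\eta+\frac{\lambda}{N}\sum_{k=1}^d r_kG^{(0)}(\zeta,e_k)\Big)G^{(0)}(\zeta,\eta)=1+\frac{\lambda}{N}\sum_{k=1}^d r_k\frac{G^{(0)}(e_k,\eta)-G^{(0)}(\zeta,\eta)}{e_k-\zeta},$$ where for $\zeta=e_k$ the quotient means its limit. In particular the numbers $G^{(0)}_{|ab|}=G^{(0)}(E_a,E_b)$ (equal to $\mathcal{G}_{kl}$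 if $E_a=e_k$, $E_b=e_l$) solve, for all $a,b\in\{1,\dots,N\}$, $$\Big(E_a+E_b+\frac{\lambda}{N}\sum_{k=1}^NG^{(0)}_{|ak|}\Big)G^{(0)}_{|ab|}=1+\frac{\lambda}{N}\sum_{k=1}^N\frac{G^{(0)}_{|kb|}-G^{(0)}_{|ab|}}{E_k-E_a},$$ where the quotients with $E_k=E_a$ mean the limits $\partial_\zeta G^{(0)}(\zeta,E_b)|_{\zeta=E_a}$. -/

import Mathlib

open Filter Topology

/-- The multiplicity with which the value `x` occurs in the tuple `E`. -/
noncomputable def multiplicityOf {N : ℕ} (E : Fin N → ℝ) (x : ℝ) : ℕ :=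
  (Finset.univ.filter fun a => E a = x).card

/-- The rational function `R(z) = z - (lam / N) ∑ j, ρ j / (ε j + z)`
(meaningful for `z` different from the poles `-ε j`). -/
noncomputable def ratR {d : ℕ} (N : ℕ) (lam : ℂ) (ε ρ : Fin d → ℂ) (z : ℂ) : ℂ :=
  z - lam / N * ∑ j, ρ j / (ε j + z)

/-- `(ε, ρ)` solves the system `e k = R (ε k)`, `r k = ρ k * R' (ε k)`, where no `ε k` is
a pole `-ε l` of `R`. -/
def SolvesSystem {d : ℕ} (N : ℕ) (e : Fin d → ℝ) (r : Fin d → ℕ) (lam : ℂ)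
    (ε ρ : Fin d → ℂ) : Prop :=
  (∀ k l, ε k + ε l ≠ 0) ∧
  (∀ k, (e k : ℂ) = ratR N lam ε ρ (ε k)) ∧
  (∀ k, (r k : ℂ) = ρ k * deriv (ratR N lam ε ρ) (ε k))

/-- The functions `εf`, `ρf` of the coupling constant are, on the disc of radius `δ` around `0`,
the implicitly defined solution of the system through `(e, r)` at coupling constant `0`:
they are holomorphic, converge to `(e, r)` at `0`, solve the system, are the only solution
in a neighbourhood of `(e, r)`, and are real and positive for real coupling constants. -/
def IsImplicitSolution {d : ℕ} (N : ℕ) (e : Fin d → ℝ) (r : Fin d → ℕ) (δ : ℝ)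
    (εf ρf : ℂ → Fin d → ℂ) : Prop :=
  DifferentiableOn ℂ εf (Metric.ball 0 δ) ∧
  DifferentiableOn ℂ ρf (Metric.ball 0 δ) ∧
  Tendsto εf (𝓝 0) (𝓝 fun k => (e k : ℂ)) ∧
  Tendsto ρf (𝓝 0) (𝓝 fun k => (r k : ℂ)) ∧
  (∀ lam ∈ Metric.ball (0 : ℂ) δ, SolvesSystem N e r lam (εf lam) (ρf lam)) ∧
  (∃ W ∈ 𝓝 ((fun k => (e k : ℂ), fun k => (r k : ℂ)) : (Fin d → ℂ) × (Fin d → ℂ)),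
    ∀ lam ∈ Metric.ball (0 : ℂ) δ, (εf lam, ρf lam) ∈ W ∧
      ∀ ε ρ : Fin d → ℂ, (ε, ρ) ∈ W → SolvesSystem N e r lam ε ρ →
        ε = εf lam ∧ ρ = ρf lam) ∧
  (∀ t : ℝ, |t| < δ → ∀ k, ∃ x y : ℝ, 0 < x ∧ 0 < y ∧ εf t k = x ∧ ρf t k = y)

/-- `v 0, …, v (d - 1)` lists without repetition the solutions `z ≠ u` of `R z = R u`
(poles of `R` excluded); so `u` and the `v j` are the `d + 1` different roots. -/
def ListsOtherRoots {d : ℕ} (N : ℕ) (lam : ℂ) (ε ρ : Fin d → ℂ) (u : ℂ)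
    (v : Fin d → ℂ) : Prop :=
  Function.Injective v ∧
  ∀ z : ℂ, (∃ j, v j = z) ↔
    (z ≠ u ∧ (∀ j, ε j + z ≠ 0) ∧ ratR N lam ε ρ z = ratR N lam ε ρ u)

/-- The constants `𝒢_{kl}`, where `hat k j` is the `j`-th further root of `R z = R (ε k)`. -/
noncomputable def constG {d : ℕ} (N : ℕ) (lam : ℂ) (ε ρ : Fin d → ℂ)
    (hat : Fin d → Fin d → ℂ) (k l : Fin d) : ℂ :=
  let R := ratR N lam ε ρ
  ((∏ j, ∏ m, (-hat k j - hat l m) / (ε j + ε m)) *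
    (∏ j ∈ Finset.univ.erase k, (ε k - ε j) / (R (ε k) - R (ε j))) *
    (∏ m ∈ Finset.univ.erase l, (ε l - ε m) / (R (ε l) - R (ε m)))) /
  (deriv R (ε k) * deriv R (ε l) * (ε k + ε l))

/-- The explicit expression of the rational function `𝒢⁽⁰⁾(z, w)`, for `p = (z, w)`. -/
noncomputable def exprG {d : ℕ} (N : ℕ) (r : Fin d → ℕ) (lam : ℂ) (ε ρ : Fin d → ℂ)
    (hat : Fin d → Fin d → ℂ) (p : ℂ × ℂ) : ℂ :=
  let R := ratR N lam ε ρ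
  let z := p.1
  let w := p.2
  1 / ((R w - R (-z)) * (R z - R (-w))) *
    (R z + R w
      + lam / N * ∑ k, (r k / (R (ε k) - R z) + r k / (R (ε k) - R w))
      + lam ^ 2 / (N : ℂ) ^ 2 * ∑ k, ∑ l,
          r k * r l * constG N lam ε ρ hat k l / ((R (ε k) - R z) * (R (ε l) - R w)))

/-- The (dense, open) set of points at which no denominator in `exprG` vanishes. -/
def domG {d : ℕ} (N : ℕ) (lam : ℂ) (ε ρ : Fin d → ℂ) : Set (ℂ × ℂ) :=
  let R := ratR N lam ε ρ
  {p | (∀ k, ε k + p.1 ≠ 0 ∧ ε k - p.1 ≠ 0 ∧ ε k + p.2 ≠ 0 ∧ ε k - p.2 ≠ 0) ∧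
    (∀ k, R (ε k) - R p.1 ≠ 0 ∧ R (ε k) - R p.2 ≠ 0) ∧
    R p.2 - R (-p.1) ≠ 0 ∧ R p.1 - R (-p.2) ≠ 0}

/-- The rational function `𝒢⁽⁰⁾`: its explicit expression, extended by continuity across
the removable zeros of the denominators. -/
noncomputable def ratG {d : ℕ} (N : ℕ) (r : Fin d → ℕ) (lam : ℂ) (ε ρ : Fin d → ℂ)
    (hat : Fin d → Fin d → ℂ) (z w : ℂ) : ℂ :=
  extendFrom (domG N lam ε ρ) (exprG N r lam ε ρ hat) (z, w)

/-- The extended planar two-point equation for `G` at `(ζ, η)`. The term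
`dslope (fun x => G x η) a ζ` is `(G a η - G ζ η) / (a - ζ)` for `ζ ≠ a`, and its limit,
the derivative of `G` in the first variable, for `ζ = a`. -/
def ExtendedTwoPointEq {d : ℕ} (N : ℕ) (e : Fin d → ℝ) (r : Fin d → ℕ) (lam : ℂ)
    (G : ℂ → ℂ → ℂ) (ζ η : ℂ) : Prop :=
  (ζ + η + lam / N * ∑ k, r k * G ζ (e k)) * G ζ η =
    1 + lam / N * ∑ k, r k * dslope (fun x => G x η) (e k : ℂ) ζ

/-- The planar two-point equation for the numbers `G_{|ab|} = G (E a) (E b)`, with sums over all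
`N` entries of the tuple `E`; the terms with `E k = E a` are limits (derivatives). -/
def TwoPointEq {N : ℕ} (E : Fin N → ℝ) (lam : ℂ) (G : ℂ → ℂ → ℂ) : Prop :=
  ∀ a b, (E a + E b + lam / N * ∑ k, G (E a) (E k)) * G (E a) (E b) =
    1 + lam / N * ∑ k, dslope (fun x => G x (E b)) (E k : ℂ) (E a : ℂ)

/-!
Write `c = λ / N`, `R z = z - c ∑ j, ρ j / (ε j + z)` and `e k = R (ε k)`.

*Algebra.* The equation `R z = R w` is equivalent to a monic polynomial equation of degree `d + 1`
(`fiberPoly`), so `R z - R w` factors over the fibre `w, v 1, …, v d` of `R w`. Two such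
factorisations contain the same double product `∏ (-v j - v' m)`, and comparing them shows that
`-c r_l 𝒢_{kl}` is the residue at `x = e l` of `∏ j, (x - R (-v j)) / ∏ l, (x - e l)`, with `v` the
further fibre of `ε k` (`IsNondegenerate.residue_eq`). Let `G_k(w)` be the value of the two-point
function at `(ε k, w)`. The same comparison with `ε k` and a generic point `w` shows that
`-c r_k G_k(w)` is the residue at `e k` of the analogous quotient formed with the further fibre `v`
of `w` (`IsNondegenerate.residue_generic_eq`). The residues of that quotient add up to
`∑ e l - ∑ R (-v j)`, which Vieta's formula and the logarithmic derivative of `fiberPoly` evaluate.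
The result is the linear relation (`IsBoundaryMatrix.boundary_relation`)
`c ∑ k, r k G_k(w) = -R w - R (-w) - c ∑ k, r k / (e k - R w)`.
Used once for `z` and once for `w`, it turns the two-point equation into the explicit formula for
`𝒢⁽⁰⁾(z, w)` (`IsBoundaryMatrix.generic_equation`).

*Regularity.* Multiplying numerator and denominator by `∏ j, (ε j - z) (ε j - w)` gives a form of
`𝒢⁽⁰⁾` without singularities near the points `(ε k, ε l)`, with value `𝒢_{kl}` there
(`clearedTwoPoint`). Composition with the local inverses of `R` makes it holomorphic, and the
equation extends from generic arguments by continuity (`extendedTwoPointEq_of_generic`).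

*Roots and the implicit solution.* The system has the form `x = x₀ + λ Φ x` with `Φ` holomorphic
near `x₀ = (e, r)`, so the inverse function theorem yields the implicit solution; it is real for
real `λ` by uniqueness and invariance under complex conjugation (`exists_implicitSolution`). The
`d + 1` roots of `R z = e k` are distinct because `R'` does not vanish on them: for positive data
the roots are real and `R' > 0` on the real axis (`hasSimpleFibers_of_pos`), and for small `λ`
critical points of `R` have values close to the numbers `-ε m` (`hasSimpleFibers_of_small`).
-/

/-! ### The fibres of `R` -/

/-- The rational function `R` with the coupling constant `λ / N` abbreviated to `c`. -/
noncomputable def ratFun {d : ℕ} (c : ℂ) (ε ρ : Fin d → ℂ) (z : ℂ) : ℂ :=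
  z - c * ∑ j, ρ j / (ε j + z)

/-- The derivative of `ratFun` in closed form. -/
noncomputable def ratSlope {d : ℕ} (c : ℂ) (ε ρ : Fin d → ℂ) (z : ℂ) : ℂ :=
  1 + c * ∑ j, ρ j / (ε j + z) ^ 2

open Polynomial in
/-- The monic polynomial `(R - x) ∏ j, (X + ε j)` of degree `d + 1`. -/
noncomputable def fiberPoly {d : ℕ} (c : ℂ) (ε ρ : Fin d → ℂ) (x : ℂ) : ℂ[X] :=
  (X - C x) * ∏ j, (X + C (ε j)) - C c * ∑ j, C (ρ j) * ∏ i ∈ Finset.univ.erase j, (X + C (ε i))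

section Fiber
open Polynomial Finset

variable {d : ℕ} {c : ℂ} {ε ρ : Fin d → ℂ}

theorem hasDerivAt_ratFun {z : ℂ} (hz : ∀ j, ε j + z ≠ 0) :
    HasDerivAt (ratFun c ε ρ) (ratSlope c ε ρ z) z := by
  have h1 : ∀ j ∈ (univ : Finset (Fin d)),
      HasDerivAt (fun z => ρ j / (ε j + z)) (-(ρ j / (ε j + z) ^ 2)) z := by
    intro j _
    have := (((hasDerivAt_id z).const_add (ε j)).inv (hz j)).const_mul (ρ j)
    refine this.congr_deriv ?_
    simp only [id]
    ring
  have := (hasDerivAt_id z).sub ((HasDerivAt.fun_sum h1).const_mul c)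
  refine this.congr_deriv ?_
  simp only [ratSlope, sum_neg_distrib]
  ring

theorem eval_fiberPoly {z : ℂ} (x : ℂ) (hz : ∀ j, ε j + z ≠ 0) :
    (fiberPoly c ε ρ x).eval z = (ratFun c ε ρ z - x) * ∏ j, (z + ε j) := by
  have key : ∀ j, ρ j * ∏ i ∈ univ.erase j, (z + ε i) = ρ j / (ε j + z) * ∏ i, (z + ε i) := by
    intro j
    rw [← mul_prod_erase univ _ (mem_univ j), add_comm z (ε j)]
    field_simp [hz j]
  simp only [fiberPoly, ratFun, eval_sub, eval_mul, eval_X, eval_C, eval_prod, eval_add,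
    eval_finsetSum, key]
  rw [← sum_mul]
  ring

theorem eval_fiberPoly_neg (x : ℂ) (l : Fin d) :
    (fiberPoly c ε ρ x).eval (-ε l) = -(c * ρ l * ∏ i ∈ univ.erase l, (ε i - ε l)) := by
  simp only [fiberPoly, eval_sub, eval_mul, eval_X, eval_C, eval_prod, eval_add, eval_finsetSum]
  rw [prod_eq_zero (mem_univ l) (by ring), sum_eq_single l]
  · rw [prod_congr rfl fun i _ => show -ε l + ε i = ε i - ε l by ring]
    ring
  · intro j _ hj
    rw [prod_eq_zero (i := l) (mem_erase.2 ⟨hj.symm, mem_univ _⟩) (by ring), mul_zero]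
  · simp

theorem degree_fiberPoly_correction_lt :
    (C c * ∑ j, C (ρ j) * ∏ i ∈ univ.erase j, (X + C (ε i)) : ℂ[X]).degree < d := by
  rw [← smul_eq_C_mul]
  refine (degree_smul_le c _).trans_lt ?_
  refine (degree_sum_le _ _).trans_lt ((Finset.sup_lt_iff (WithBot.bot_lt_coe d)).2 ?_)
  intro j _
  rw [← smul_eq_C_mul]
  refine (degree_smul_le _ _).trans_lt ?_
  rw [degree_prod, sum_congr rfl fun i _ => degree_X_add_C (ε i)]
  simp only [sum_const, card_erase_of_mem (mem_univ j), card_univ, Fintype.card_fin]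
  have : 0 < d := j.pos
  simp only [nsmul_eq_mul, mul_one]
  exact WithBot.coe_lt_coe.2 (Nat.cast_lt.2 (Nat.sub_lt this one_pos))

theorem monic_fiberPoly_main (x : ℂ) : ((X - C x) * ∏ j, (X + C (ε j)) : ℂ[X]).Monic :=
  (monic_X_sub_C x).mul (monic_prod_of_monic _ _ fun j _ => monic_X_add_C (ε j))

theorem natDegree_fiberPoly_main (x : ℂ) :
    ((X - C x) * ∏ j, (X + C (ε j)) : ℂ[X]).natDegree = d + 1 := by
  rw [(monic_X_sub_C x).natDegree_mul (monic_prod_of_monic _ _ fun j _ => monic_X_add_C (ε j)),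
    natDegree_prod_of_monic _ _ fun j _ => monic_X_add_C (ε j)]
  simp [add_comm]

theorem degree_fiberPoly_correction_lt_main (x : ℂ) :
    (C c * ∑ j, C (ρ j) * ∏ i ∈ univ.erase j, (X + C (ε i)) : ℂ[X]).degree <
      ((X - C x) * ∏ j, (X + C (ε j)) : ℂ[X]).degree := by
  refine degree_fiberPoly_correction_lt.trans ?_
  rw [degree_eq_natDegree (monic_fiberPoly_main x).ne_zero, natDegree_fiberPoly_main]
  exact_mod_cast Nat.lt_succ_self d

theorem monic_fiberPoly (x : ℂ) : (fiberPoly c ε ρ x).Monic :=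
  (monic_fiberPoly_main x).sub_of_left (degree_fiberPoly_correction_lt_main x)

theorem natDegree_fiberPoly (x : ℂ) : (fiberPoly c ε ρ x).natDegree = d + 1 := by
  rw [← natDegree_fiberPoly_main (ε := ε) x]
  exact natDegree_eq_of_degree_eq
    (degree_sub_eq_left_of_degree_lt (degree_fiberPoly_correction_lt_main x))

theorem coeff_fiberPoly (x : ℂ) : (fiberPoly c ε ρ x).coeff d = -x + ∑ j, ε j := by
  have h : (C c * ∑ j, C (ρ j) * ∏ i ∈ univ.erase j, (X + C (ε i)) : ℂ[X]).coeff d = 0 :=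
    coeff_eq_zero_of_degree_lt degree_fiberPoly_correction_lt
  have h2 := (monic_X_sub_C x).nextCoeff_mul
    (monic_prod_of_monic univ (fun j => X + C (ε j)) fun j _ => monic_X_add_C (ε j))
  rw [Monic.nextCoeff_prod _ _ fun j _ => monic_X_add_C (ε j),
    nextCoeff_of_natDegree_pos (by rw [natDegree_fiberPoly_main]; omega),
    natDegree_fiberPoly_main] at h2
  simp only [nextCoeff_X_sub_C, nextCoeff_X_add_C, Nat.add_sub_cancel] at h2
  rw [fiberPoly, coeff_sub, h, h2, sub_zero]

/-- `w` together with the `v m` are, with multiplicities, the `d + 1` solutions of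
`R z = R w`. -/
def IsFiber (c : ℂ) (ε ρ : Fin d → ℂ) (w : ℂ) (v : Fin d → ℂ) : Prop :=
  fiberPoly c ε ρ (ratFun c ε ρ w) = (X - C w) * ∏ m, (X - C (v m))

theorem exists_isFiber {w : ℂ} (hw : ∀ j, ε j + w ≠ 0) : ∃ v, IsFiber c ε ρ w v := by
  set p := fiberPoly c ε ρ (ratFun c ε ρ w) with hp
  have hroot : p.IsRoot w := by simp [hp, eval_fiberPoly _ hw]
  obtain ⟨q, hq⟩ := dvd_iff_isRoot.2 hroot
  have hqm : q.Monic := (monic_X_sub_C w).of_mul_monic_left (hq ▸ monic_fiberPoly _)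
  have hdeg : q.natDegree = d := by
    have h := natDegree_fiberPoly (c := c) (ε := ε) (ρ := ρ) (ratFun c ε ρ w)
    rw [← hp, hq, (monic_X_sub_C w).natDegree_mul hqm, natDegree_X_sub_C] at h
    omega
  have hs := IsAlgClosed.splits q
  have hcard : q.roots.toList.length = d := by
    rw [Multiset.length_toList, ← hs.natDegree_eq_card_roots, hdeg]
  refine ⟨fun m => q.roots.toList.get (m.cast hcard.symm), ?_⟩
  have h1 : q = (q.roots.map fun a => X - C a).prod := hs.eq_prod_roots_of_monic hqm
  have h2 : ∏ m : Fin d, (X - C (q.roots.toList.get (m.cast hcard.symm))) =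
      (q.roots.map fun a => X - C a).prod := by
    conv_rhs => rw [← Multiset.coe_toList q.roots]
    rw [Multiset.map_coe, Multiset.prod_coe, ← Fin.prod_univ_fun_getElem]
    exact Fintype.prod_equiv (finCongr hcard.symm) _ _ fun m => rfl
  rw [IsFiber, h2, ← h1, ← hq]

variable {w : ℂ} {v : Fin d → ℂ}

theorem IsFiber.sub_mul_prod (h : IsFiber c ε ρ w v) {z : ℂ} (hz : ∀ j, ε j + z ≠ 0) :
    (ratFun c ε ρ z - ratFun c ε ρ w) * ∏ j, (z + ε j) = (z - w) * ∏ m, (z - v m) := by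
  rw [← eval_fiberPoly _ hz, h]
  simp [eval_prod]

theorem IsFiber.eval_neg (h : IsFiber c ε ρ w v) (l : Fin d) :
    (-ε l - w) * ∏ m, (-ε l - v m) = -(c * ρ l * ∏ i ∈ univ.erase l, (ε i - ε l)) := by
  rw [← eval_fiberPoly_neg (ratFun c ε ρ w), h]
  simp [eval_prod]

theorem eventually_add_ne_zero {z : ℂ} (hz : ∀ j, ε j + z ≠ 0) :
    ∀ᶠ y in 𝓝 z, ∀ j, ε j + y ≠ 0 :=
  eventually_all.2 fun j =>
    (continuous_const.add continuous_id).continuousAt.eventually_ne (hz j)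

theorem eval_derivative_fiberPoly {z x : ℂ} (hz : ∀ j, ε j + z ≠ 0)
    (hx : ratFun c ε ρ z = x) :
    (derivative (fiberPoly c ε ρ x)).eval z = ratSlope c ε ρ z * ∏ j, (z + ε j) := by
  have h1 : HasDerivAt (fun y => (ratFun c ε ρ y - x) * ∏ j, (y + ε j))
      (ratSlope c ε ρ z * ∏ j, (z + ε j)
        + (ratFun c ε ρ z - x) * deriv (fun y => ∏ j, (y + ε j)) z) z :=
    ((hasDerivAt_ratFun hz).sub_const x).mul
      (DifferentiableAt.hasDerivAt (by fun_prop))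
  have h2 : (fun y => (fiberPoly c ε ρ x).eval y) =ᶠ[𝓝 z]
      fun y => (ratFun c ε ρ y - x) * ∏ j, (y + ε j) := by
    filter_upwards [eventually_add_ne_zero hz] with y hy using eval_fiberPoly x hy
  have h3 := ((fiberPoly c ε ρ x).hasDerivAt z).unique (h1.congr_of_eventuallyEq h2)
  rw [h3, hx]
  ring

theorem IsFiber.slope_mul_prod (h : IsFiber c ε ρ w v) (hw : ∀ j, ε j + w ≠ 0) :
    ratSlope c ε ρ w * ∏ j, (w + ε j) = ∏ m, (w - v m) := by
  rw [← eval_derivative_fiberPoly hw rfl, h]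
  simp [eval_prod, derivative_mul]

/-- Sum of the fibre: comparison of the coefficients of degree `d`. -/
theorem IsFiber.sum_eq (h : IsFiber c ε ρ w v) :
    w + ∑ m, v m = ratFun c ε ρ w - ∑ j, ε j := by
  have h1 : ((X - C w) * ∏ m, (X - C (v m)) : ℂ[X]).coeff d = -w - ∑ m, v m := by
    have h2 := (monic_X_sub_C w).nextCoeff_mul
      (monic_prod_of_monic univ (fun m => X - C (v m)) fun m _ => monic_X_sub_C (v m))
    have h3 : ((X - C w) * ∏ m, (X - C (v m)) : ℂ[X]).natDegree = d + 1 := by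
      rw [← h, natDegree_fiberPoly]
    rw [prod_X_sub_C_nextCoeff, nextCoeff_of_natDegree_pos (by rw [h3]; omega), h3] at h2
    simp only [nextCoeff_X_sub_C, Nat.add_sub_cancel] at h2
    rw [h2]; ring
  rw [← h, coeff_fiberPoly] at h1
  linear_combination h1

/-- Every member of the fibre is a regular point of `R` with value `R w`. -/
theorem IsFiber.mem (h : IsFiber c ε ρ w v) (hc : c ≠ 0) (hρ : ∀ k, ρ k ≠ 0)
    (hε : Function.Injective ε) (m : Fin d) :
    (∀ j, ε j + v m ≠ 0) ∧ ratFun c ε ρ (v m) = ratFun c ε ρ w := by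
  have h0 : (fiberPoly c ε ρ (ratFun c ε ρ w)).eval (v m) = 0 := by
    rw [h, eval_mul, eval_prod, prod_eq_zero (mem_univ m) (by simp), mul_zero]
  have h1 : ∀ j, ε j + v m ≠ 0 := by
    intro j hj
    rw [show v m = -ε j by linear_combination hj, eval_fiberPoly_neg] at h0
    refine neg_ne_zero.2 (mul_ne_zero (mul_ne_zero hc (hρ j)) (prod_ne_zero_iff.2 ?_)) h0
    intro i hi
    exact sub_ne_zero.2 (hε.ne (mem_erase.1 hi).1)
  rw [eval_fiberPoly _ h1] at h0
  refine ⟨h1, sub_eq_zero.1 ((mul_eq_zero.1 h0).resolve_right (prod_ne_zero_iff.2 fun j _ => ?_))⟩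
  rw [add_comm]; exact h1 j

theorem IsFiber.eq_or_exists (h : IsFiber c ε ρ w v) {z : ℂ} (hz : ∀ j, ε j + z ≠ 0)
    (hzw : ratFun c ε ρ z = ratFun c ε ρ w) : z = w ∨ ∃ m, v m = z := by
  have := h.sub_mul_prod hz
  rw [hzw, sub_self, zero_mul, eq_comm, mul_eq_zero, prod_eq_zero_iff] at this
  rcases this with h | ⟨m, -, h⟩
  · exact Or.inl (sub_eq_zero.1 h)
  · exact Or.inr ⟨m, (sub_eq_zero.1 h).symm⟩

/-- Logarithmic derivative of the fibre polynomial. -/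
theorem IsFiber.sum_inv (h : IsFiber c ε ρ w v) {z : ℂ} (hz : ∀ j, ε j + z ≠ 0)
    (hzw : ratFun c ε ρ z ≠ ratFun c ε ρ w) :
    1 / (z - w) + ∑ m, 1 / (z - v m) =
      ratSlope c ε ρ z / (ratFun c ε ρ z - ratFun c ε ρ w) + ∑ j, 1 / (ε j + z) := by
  have hz' : ∀ j, z + ε j ≠ 0 := fun j => by rw [add_comm]; exact hz j
  have hne := mul_ne_zero (sub_ne_zero.2 hzw) (prod_ne_zero_iff.2 fun j (_ : j ∈ univ) => hz' j)
  rw [h.sub_mul_prod hz] at hne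
  have hw0 := left_ne_zero_of_mul hne
  have hv0 := fun m => prod_ne_zero_iff.1 (right_ne_zero_of_mul hne) m (mem_univ m)
  have h2 : (fun y => (y - w) * ∏ m, (y - v m)) =ᶠ[𝓝 z]
      fun y => (ratFun c ε ρ y - ratFun c ε ρ w) * ∏ j, (y + ε j) := by
    filter_upwards [eventually_add_ne_zero hz] with y hy using (h.sub_mul_prod hy).symm
  have hd := (hasDerivAt_ratFun (c := c) (ρ := ρ) hz).sub_const (ratFun c ε ρ w)
  have h3 := (logDeriv_congr_nhds h2).self_of_nhds
  have hprod : ∀ a : Fin d → ℂ, (∀ m, z - a m ≠ 0) →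
      logDeriv (fun y => ∏ m, (y - a m)) z = ∑ m, logDeriv (fun y => y - a m) z := by
    intro a ha
    have := logDeriv_prod (s := univ) (f := fun m y => y - a m) (x := z)
      (fun m _ => ha m) (fun m _ => by fun_prop)
    simpa only [Finset.prod_fn] using this
  have hL := logDeriv_mul (f := fun y => y - w) (g := fun y => ∏ m, (y - v m)) z hw0
    (prod_ne_zero_iff.2 fun m _ => hv0 m) (by fun_prop) (by fun_prop)
  have hR := logDeriv_mul (f := fun y => ratFun c ε ρ y - ratFun c ε ρ w)
    (g := fun y => ∏ j, (y - -ε j)) z (sub_ne_zero.2 hzw)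
    (prod_ne_zero_iff.2 fun j _ => by simpa using hz' j) hd.differentiableAt (by fun_prop)
  rw [hprod _ hv0] at hL
  rw [hprod _ fun j => by simpa using hz' j] at hR
  simp only [sub_neg_eq_add] at hR
  have h4 := hL.symm.trans (h3.trans hR)
  simp only [logDeriv_apply, hd.deriv, deriv_sub_const, deriv_add_const, deriv_id''] at h4
  simpa only [add_comm] using h4

end Fiber

/-! ### Partial fractions -/

section Lagrange
open Polynomial Finset

variable {d : ℕ} {e : Fin d → ℂ}

/-- The residue at `e l` of `∏ j, (x - a j) / ∏ l, (x - e l)`. -/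
noncomputable def nodeResidue {d : ℕ} (e a : Fin d → ℂ) (l : Fin d) : ℂ :=
  (∏ j, (e l - a j)) / ∏ m ∈ Finset.univ.erase l, (e l - e m)

theorem degree_prod_sub_prod_lt (e a : Fin d → ℂ) :
    ((∏ j, (X - C (a j))) - ∏ j, (X - C (e j)) : ℂ[X]).degree < (univ : Finset (Fin d)).card := by
  have hm : ∀ b : Fin d → ℂ, (∏ j, (X - C (b j)) : ℂ[X]).Monic := fun b =>
    monic_prod_of_monic _ _ fun j _ => monic_X_sub_C _
  have hd : ∀ b : Fin d → ℂ, (∏ j, (X - C (b j)) : ℂ[X]).degree = (univ : Finset (Fin d)).card := by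
    intro b
    simp [degree_prod]
  rw [← hd a]
  exact degree_sub_lt_left (by rw [hd, hd]) (hm a).ne_zero
    (by rw [(hm a).leadingCoeff, (hm e).leadingCoeff])

theorem eval_prod_sub_prod_node (e a : Fin d → ℂ) (l : Fin d) :
    ((∏ j, (X - C (a j))) - ∏ j, (X - C (e j)) : ℂ[X]).eval (e l) = ∏ j, (e l - a j) := by
  simp only [eval_sub, eval_prod, eval_X, eval_C]
  rw [prod_eq_zero (f := fun j => e l - e j) (mem_univ l) (sub_self _), sub_zero]

/-- Partial fraction decomposition. -/
theorem prod_div_prod_eq (he : Function.Injective e) (a : Fin d → ℂ) {x : ℂ}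
    (hx : ∀ l, x ≠ e l) :
    (∏ j, (x - a j)) / ∏ l, (x - e l) = 1 + ∑ l, nodeResidue e a l / (x - e l) := by
  have h := congrArg (eval x) (Lagrange.eq_interpolate (s := univ) (v := e) he.injOn
    (degree_prod_sub_prod_lt e a))
  rw [Lagrange.interpolate_eq_sum] at h
  simp only [eval_prod_sub_prod_node, eval_finsetSum, eval_mul, eval_C] at h
  simp only [eval_sub, eval_prod, eval_X, eval_C] at h
  have hne : ∏ l, (x - e l) ≠ 0 := prod_ne_zero_iff.2 fun l _ => sub_ne_zero.2 (hx l)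
  rw [div_eq_iff hne, add_mul, one_mul, sum_mul, ← sub_eq_iff_eq_add', h]
  refine sum_congr rfl fun l _ => ?_
  rw [← mul_prod_erase univ (fun l => x - e l) (mem_univ l), nodeResidue]
  field_simp [sub_ne_zero.2 (hx l)]

theorem sum_nodeResidue (he : Function.Injective e) (a : Fin d → ℂ) :
    ∑ l, nodeResidue e a l = ∑ l, e l - ∑ j, a j := by
  rcases Nat.eq_zero_or_pos d with rfl | hd
  · simp
  have h := Lagrange.coeff_eq_sum (s := univ) (v := e) he.injOn (degree_prod_sub_prod_lt e a)
  simp only [eval_prod_sub_prod_node] at h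
  simp only [nodeResidue]
  rw [← h, coeff_sub, prod_X_sub_C_coeff_card_pred _ _ (by simpa using hd),
    prod_X_sub_C_coeff_card_pred _ _ (by simpa using hd)]
  ring

end Lagrange

/-! ### Products over two fibres -/

section Products
open Finset

variable {d : ℕ} {c : ℂ} {ε ρ : Fin d → ℂ}

/-- The nondegeneracy satisfied by the solutions of the system: `R` has the `d` distinct simple
poles `-ε j`, takes different values at the `ε k`, and is unramified there. -/
structure IsNondegenerate {d : ℕ} (c : ℂ) (ε ρ : Fin d → ℂ) : Prop where
  coupling_ne : c ≠ 0
  weight_ne : ∀ k, ρ k ≠ 0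
  add_ne : ∀ k l, ε k + ε l ≠ 0
  value_injective : Function.Injective fun k => ratFun c ε ρ (ε k)
  slope_ne : ∀ k, ratSlope c ε ρ (ε k) ≠ 0

theorem IsNondegenerate.injective (h : IsNondegenerate c ε ρ) : Function.Injective ε :=
  fun _ _ hkl => h.value_injective (congrArg (ratFun c ε ρ) hkl)

theorem IsFiber.prod_ratFun_neg_sub {w : ℂ} {v v' : Fin d → ℂ} (h : IsFiber c ε ρ w v')
    (hv : ∀ j m, ε m ≠ v j) :
    (∏ j, (ratFun c ε ρ (-v j) - ratFun c ε ρ w)) * ∏ j, ∏ m, (ε m - v j) =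
      (∏ j, (-v j - w)) * ∏ j, ∏ m, (-v j - v' m) := by
  rw [← prod_mul_distrib, ← prod_mul_distrib]
  refine prod_congr rfl fun j _ => ?_
  rw [← h.sub_mul_prod fun m => by rw [← sub_eq_add_neg]; exact sub_ne_zero.2 (hv j m)]
  simp only [neg_add_eq_sub]

theorem prod_erase_swap (a : Fin d → ℂ) (l : Fin d) :
    ∏ i ∈ univ.erase l, (a i - a l) = (-1) ^ (d - 1) * ∏ i ∈ univ.erase l, (a l - a i) := by
  rw [prod_congr rfl fun i _ => show a i - a l = (-1) * (a l - a i) by ring, prod_mul_distrib,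
    prod_const, card_erase_of_mem (mem_univ l), card_univ, Fintype.card_fin]

theorem prod_sub_swap (l : Fin d) (f g : Fin d → ℂ) :
    ∏ j, (f j - g j) = -(-1) ^ (d - 1) * ∏ j, (g j - f j) := by
  have hd : d = d - 1 + 1 := (Nat.sub_add_cancel l.pos).symm
  rw [prod_congr rfl fun i _ => show f i - g i = (-1) * (g i - f i) by ring, prod_mul_distrib,
    prod_const, card_univ, Fintype.card_fin]
  nth_rw 1 [hd]
  rw [pow_succ]
  ring

theorem neg_one_pow_sq (n : ℕ) : ((-1 : ℂ) ^ n) ^ 2 = 1 := by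
  rw [← pow_mul, mul_comm, pow_mul]; simp

variable (h : IsNondegenerate c ε ρ)
include h

theorem IsNondegenerate.fiber_ne {w : ℂ} {v : Fin d → ℂ} (hv : IsFiber c ε ρ w v)
    (hw : ∀ l, ratFun c ε ρ w ≠ ratFun c ε ρ (ε l)) (j m : Fin d) : ε m ≠ v j := by
  intro hm
  have := (hv.mem h.coupling_ne h.weight_ne h.injective j).2
  rw [← hm] at this
  exact hw m this.symm

theorem IsNondegenerate.fiber_node_ne {k : Fin d} {v : Fin d → ℂ} (hv : IsFiber c ε ρ (ε k) v)
    (j m : Fin d) : ε m ≠ v j := by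
  intro hm
  have := (hv.mem h.coupling_ne h.weight_ne h.injective j).2
  rw [← hm] at this
  obtain rfl := h.value_injective this
  have h1 := hv.slope_mul_prod (h.add_ne · _)
  rw [prod_eq_zero (f := fun i => ε m - v i) (mem_univ j) (sub_eq_zero.2 hm)] at h1
  exact mul_ne_zero (h.slope_ne m) (prod_ne_zero_iff.2 fun j _ => h.add_ne m j) h1

theorem IsNondegenerate.prod_prod_node_sub {k : Fin d} {v : Fin d → ℂ}
    (hv : IsFiber c ε ρ (ε k) v) :
    (∏ j, ∏ m, (ε m - v j)) * ∏ m ∈ univ.erase k, (ε k - ε m) =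
      ratSlope c ε ρ (ε k) * (∏ m ∈ univ.erase k, (ratFun c ε ρ (ε k) - ratFun c ε ρ (ε m))) *
        ∏ m, ∏ j, (ε m + ε j) := by
  rw [Finset.prod_comm, ← mul_prod_erase univ (fun m => ∏ j, (ε m - v j)) (mem_univ k),
    ← mul_prod_erase univ (fun m => ∏ j, (ε m + ε j)) (mem_univ k),
    ← hv.slope_mul_prod (h.add_ne · _)]
  have : (∏ m ∈ univ.erase k, ∏ j, (ε m - v j)) * ∏ m ∈ univ.erase k, (ε k - ε m) =
      (∏ m ∈ univ.erase k, (ratFun c ε ρ (ε k) - ratFun c ε ρ (ε m))) *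
        ∏ m ∈ univ.erase k, ∏ j, (ε m + ε j) := by
    rw [← prod_mul_distrib, ← prod_mul_distrib]
    refine prod_congr rfl fun m _ => ?_
    linear_combination hv.sub_mul_prod (h.add_ne · m)
  linear_combination (ratSlope c ε ρ (ε k) * ∏ j, (ε k + ε j)) * this

theorem IsNondegenerate.prod_prod_node_sub_generic {w : ℂ} {v : Fin d → ℂ}
    (hv : IsFiber c ε ρ w v) :
    (∏ j, ∏ m, (ε m - v j)) * ∏ m, (ε m - w) =
      (∏ m, (ratFun c ε ρ (ε m) - ratFun c ε ρ w)) * ∏ m, ∏ j, (ε m + ε j) := by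
  rw [Finset.prod_comm, ← prod_mul_distrib, ← prod_mul_distrib]
  refine prod_congr rfl fun m _ => ?_
  linear_combination -hv.sub_mul_prod (h.add_ne · m)

theorem IsNondegenerate.prod_prod_add_ne : ∏ m, ∏ j, (ε m + ε j) ≠ 0 :=
  prod_ne_zero_iff.2 fun _ _ => prod_ne_zero_iff.2 fun _ _ => h.add_ne _ _

theorem IsNondegenerate.prod_value_sub_ne (k : Fin d) :
    ∏ m ∈ univ.erase k, (ratFun c ε ρ (ε k) - ratFun c ε ρ (ε m)) ≠ 0 :=
  prod_ne_zero_iff.2 fun _ hm => sub_ne_zero.2 fun hkm =>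
    (mem_erase.1 hm).1 (h.value_injective hkm).symm

/-- The numbers `𝒢_{kl}` are residues of a rational function with prescribed zeros `R (-v)`,
for `v` in the fibre of `ε k`. -/
theorem IsNondegenerate.residue_eq {k l : Fin d} {v v' : Fin d → ℂ}
    (hk : IsFiber c ε ρ (ε k) v) (hl : IsFiber c ε ρ (ε l) v') :
    c * (ρ l * ratSlope c ε ρ (ε l)) *
      (((∏ j, ∏ m, (-v j - v' m) / (ε j + ε m)) *
        (∏ j ∈ univ.erase k, (ε k - ε j) / (ratFun c ε ρ (ε k) - ratFun c ε ρ (ε j))) *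
        (∏ m ∈ univ.erase l, (ε l - ε m) / (ratFun c ε ρ (ε l) - ratFun c ε ρ (ε m)))) /
      (ratSlope c ε ρ (ε k) * ratSlope c ε ρ (ε l) * (ε k + ε l))) =
    -nodeResidue (fun m => ratFun c ε ρ (ε m)) (fun j => ratFun c ε ρ (-v j)) l := by
  have e1 := hl.prod_ratFun_neg_sub (h.fiber_node_ne hk)
  have e2 := h.prod_prod_node_sub hk
  have e3 := hk.eval_neg l
  rw [prod_erase_swap] at e3
  rw [prod_congr rfl fun j _ => show -ε l - v j = -v j - ε l by ring] at e3
  have hs := neg_one_pow_sq (d - 1)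
  have hS := h.prod_prod_add_ne
  have hB := h.prod_value_sub_ne
  have hQ : ∏ j, ∏ m, (ε m - v j) ≠ 0 := prod_ne_zero_iff.2 fun j _ =>
    prod_ne_zero_iff.2 fun m _ => sub_ne_zero.2 (h.fiber_node_ne hk j m)
  simp only [nodeResidue, prod_div_distrib]
  rw [prod_sub_swap l (fun _ => ratFun c ε ρ (ε l))]
  have hBk := hB k
  have hBl := hB l
  have hσk := h.slope_ne k
  have hσl := h.slope_ne l
  have hkl := h.add_ne k l
  generalize ∏ m ∈ univ.erase k, (ratFun c ε ρ (ε k) - ratFun c ε ρ (ε m)) = Bk at *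
  generalize ∏ m ∈ univ.erase l, (ratFun c ε ρ (ε l) - ratFun c ε ρ (ε m)) = Bl at *
  generalize ∏ j, (ratFun c ε ρ (-v j) - ratFun c ε ρ (ε l)) = X at *
  generalize ∏ j, ∏ m, (ε m - v j) = Q at *
  generalize ∏ j, ∏ m, (-v j - v' m) = T at *
  generalize ∏ j, ∏ m, (ε j + ε m) = S at *
  generalize ∏ j, (-v j - ε l) = Y at *
  generalize ∏ m ∈ univ.erase k, (ε k - ε m) = Ak at *
  generalize ∏ m ∈ univ.erase l, (ε l - ε m) = Al at *
  generalize ratSlope c ε ρ (ε k) = σk at *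
  generalize ratSlope c ε ρ (ε l) = σl at *
  generalize (-1 : ℂ) ^ (d - 1) = s at *
  generalize ε k = εk at *
  generalize ε l = εl at *
  generalize ρ l = ρl at *
  have key : c * ρl * T * Ak * Al = s * X * S * Bk * σk * (εk + εl) := by
    linear_combination (-s * X * (εk + εl)) * (-e2) + (-s * Ak * (εk + εl)) * e1
      - (T * Ak * s) * (-e3) - (c * ρl * T * Ak * Al) * hs
  field_simp
  linear_combination key

/-- The analogue of `residue_eq` in which one of the two nodes is replaced by a generic point. -/
theorem IsNondegenerate.residue_generic_eq {k : Fin d} {w : ℂ} {v v' : Fin d → ℂ}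
    (hk : IsFiber c ε ρ (ε k) v) (hw : IsFiber c ε ρ w v')
    (hwe : ∀ l, ratFun c ε ρ w ≠ ratFun c ε ρ (ε l))
    (hneg : ratFun c ε ρ (ε k) ≠ ratFun c ε ρ (-w)) :
    c * (ρ k * ratSlope c ε ρ (ε k)) / (ratFun c ε ρ (ε k) - ratFun c ε ρ (-w)) *
      ((∏ j, (ratFun c ε ρ w - ratFun c ε ρ (-v j))) /
        ∏ l, (ratFun c ε ρ w - ratFun c ε ρ (ε l))) =
    -nodeResidue (fun m => ratFun c ε ρ (ε m)) (fun j => ratFun c ε ρ (-v' j)) k := by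
  have hwε : ∀ j, ε j ≠ w := fun j hj => hwe j (by rw [hj])
  have e1 := hw.prod_ratFun_neg_sub (h.fiber_node_ne hk)
  have e1' := hk.prod_ratFun_neg_sub (h.fiber_ne hw hwe)
  rw [Finset.prod_comm (f := fun j m => -v' j - v m)] at e1'
  simp only [fun j m => show -v' m - v j = -v j - v' m by ring] at e1'
  have e2 := h.prod_prod_node_sub hk
  have e2' := h.prod_prod_node_sub_generic hw
  have e3 := hw.eval_neg k
  rw [prod_erase_swap] at e3
  rw [prod_congr rfl fun j _ => show -ε k - v' j = -v' j - ε k by ring] at e3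
  have e4 := hk.sub_mul_prod (z := -w)
    fun j => by rw [← sub_eq_add_neg]; exact sub_ne_zero.2 (hwε j)
  simp only [neg_add_eq_sub] at e4
  rw [prod_congr rfl fun j _ => show -w - v j = -v j - w by ring] at e4
  have hs := neg_one_pow_sq (d - 1)
  have hs0 : (-1 : ℂ) ^ (d - 1) ≠ 0 := pow_ne_zero _ (by norm_num)
  have hS := h.prod_prod_add_ne
  have hBk := h.prod_value_sub_ne k
  have hQ : ∏ j, ∏ m, (ε m - v j) ≠ 0 := prod_ne_zero_iff.2 fun j _ =>
    prod_ne_zero_iff.2 fun m _ => sub_ne_zero.2 (h.fiber_node_ne hk j m)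
  have hE : ∏ l, (ratFun c ε ρ (ε l) - ratFun c ε ρ w) ≠ 0 :=
    prod_ne_zero_iff.2 fun l _ => sub_ne_zero.2 (hwe l).symm
  have hq := sub_ne_zero.2 hneg
  simp only [nodeResidue]
  rw [prod_sub_swap k (fun _ => ratFun c ε ρ (ε k)),
    prod_sub_swap k (fun _ => ratFun c ε ρ w) (fun j => ratFun c ε ρ (-v j)),
    prod_sub_swap k (fun _ => ratFun c ε ρ w) (fun j => ratFun c ε ρ (ε j))]
  generalize ∏ m ∈ univ.erase k, (ratFun c ε ρ (ε k) - ratFun c ε ρ (ε m)) = Bk at *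
  generalize ∏ m, (ratFun c ε ρ (ε m) - ratFun c ε ρ w) = Ew at *
  generalize ∏ j, (ratFun c ε ρ (-v j) - ratFun c ε ρ w) = X at *
  generalize ∏ j, (ratFun c ε ρ (-v' j) - ratFun c ε ρ (ε k)) = X' at *
  generalize ∏ j, ∏ m, (ε m - v j) = Q at *
  generalize ∏ j, ∏ m, (ε m - v' j) = Q' at *
  generalize ∏ j, ∏ m, (-v j - v' m) = T at *
  generalize ∏ j, ∏ m, (ε j + ε m) = S at *
  generalize ∏ j, (-v j - w) = Z at *
  generalize ∏ j, (-v' j - ε k) = Y at *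
  generalize ∏ m, (ε m - w) = W at *
  generalize ∏ m ∈ univ.erase k, (ε k - ε m) = Ak at *
  generalize ratSlope c ε ρ (ε k) = σk at *
  generalize (-1 : ℂ) ^ (d - 1) = s at *
  generalize ratFun c ε ρ (ε k) = ek at *
  generalize ratFun c ε ρ (-w) = x at *
  generalize ε k = εk at *
  generalize ρ k = ρk at *
  have key : c * ρk * σk * X * Bk = s * X' * (ek - x) * Ew := by
    refine mul_right_cancel₀ (mul_ne_zero hQ hS) ?_
    linear_combination (-c * ρk * X * Q) * e2 + (c * ρk * Q * Ak) * e1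
      + (s * X' * (ek - x) * Q) * e2' - (s * W * (ek - x) * Q) * e1'
      + (s * Y * T * Q) * e4 + (s * T * Q * Z) * e3 - (c * ρk * T * Q * Ak * Z) * hs
  field_simp
  linear_combination key

end Products

/-! ### The two-point equation at generic points -/

section TwoPoint
open Finset

variable {d : ℕ} {c : ℂ} {ε ρ r : Fin d → ℂ} {hat K : Fin d → Fin d → ℂ}

/-- The properties of the constants `K k l = 𝒢_{kl}` from which the two-point equation follows. -/
structure IsBoundaryMatrix {d : ℕ} (c : ℂ) (ε ρ r : Fin d → ℂ) (hat K : Fin d → Fin d → ℂ) :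
    Prop where
  nondeg : IsNondegenerate c ε ρ
  mult_eq : ∀ k, r k = ρ k * ratSlope c ε ρ (ε k)
  fiber : ∀ k, IsFiber c ε ρ (ε k) (hat k)
  residue : ∀ k l, c * r l * K k l =
    -nodeResidue (fun m => ratFun c ε ρ (ε m)) (fun j => ratFun c ε ρ (-hat k j)) l
  symm : ∀ k l, K k l = K l k

/-- The value of the two-point function at `(ε k, w)`. -/
noncomputable def boundaryTwoPoint {d : ℕ} (c : ℂ) (ε ρ r : Fin d → ℂ) (K : Fin d → Fin d → ℂ)
    (k : Fin d) (w : ℂ) : ℂ :=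
  (1 + c * ∑ l, r l * K k l / (ratFun c ε ρ (ε l) - ratFun c ε ρ w)) /
    (ratFun c ε ρ (ε k) - ratFun c ε ρ (-w))

theorem IsBoundaryMatrix.boundary_eq_nodeResidue (H : IsBoundaryMatrix c ε ρ r hat K) {w : ℂ}
    {v : Fin d → ℂ} (hw : IsFiber c ε ρ w v)
    (hwe : ∀ l, ratFun c ε ρ w ≠ ratFun c ε ρ (ε l)) {k : Fin d}
    (hneg : ratFun c ε ρ (ε k) ≠ ratFun c ε ρ (-w)) :
    c * (r k * boundaryTwoPoint c ε ρ r K k w) =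
      -nodeResidue (fun m => ratFun c ε ρ (ε m)) (fun j => ratFun c ε ρ (-v j)) k := by
  rw [← H.nondeg.residue_generic_eq (H.fiber k) hw hwe hneg,
    prod_div_prod_eq H.nondeg.value_injective _ hwe, boundaryTwoPoint, ← H.mult_eq, mul_sum]
  have : ∀ l, c * (r l * K k l / (ratFun c ε ρ (ε l) - ratFun c ε ρ w)) =
      nodeResidue (fun m => ratFun c ε ρ (ε m)) (fun j => ratFun c ε ρ (-hat k j)) l /
        (ratFun c ε ρ w - ratFun c ε ρ (ε l)) := by
    intro l
    rw [← neg_sub (ratFun c ε ρ w), div_neg, mul_neg, ← mul_div_assoc, ← mul_assoc, H.residue,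
      neg_div, neg_neg]
  rw [sum_congr rfl fun l _ => this l]
  ring

/-- The sum of `R (-v)` over the whole fibre `v` of `w`. -/
theorem IsFiber.sum_ratFun_neg {w : ℂ} {v : Fin d → ℂ} (hv : IsFiber c ε ρ w v)
    (h : IsNondegenerate c ε ρ) (hwe : ∀ l, ratFun c ε ρ w ≠ ratFun c ε ρ (ε l)) :
    ratFun c ε ρ (-w) + ∑ m, ratFun c ε ρ (-v m) =
      -ratFun c ε ρ w + ∑ l, ratFun c ε ρ (ε l) -
        c * ∑ k, ρ k * ratSlope c ε ρ (ε k) / (ratFun c ε ρ (ε k) - ratFun c ε ρ w) := by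
  have h1 : ∀ j, ρ j * (1 / (ε j - w) + ∑ m, 1 / (ε j - v m)) =
      ρ j * ratSlope c ε ρ (ε j) / (ratFun c ε ρ (ε j) - ratFun c ε ρ w) +
        ∑ i, ρ j / (ε i + ε j) := by
    intro j
    rw [hv.sum_inv (h.add_ne · j) (hwe j).symm, mul_add, mul_sum, mul_div_assoc]
    simp only [mul_one_div]
  have h2 : ∑ l, ratFun c ε ρ (ε l) = ∑ l, ε l - c * ∑ j, ∑ i, ρ j / (ε i + ε j) := by
    simp only [ratFun, sum_sub_distrib, ← mul_sum]
    rw [Finset.sum_comm]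
    simp only [add_comm]
  have h3 : ratFun c ε ρ (-w) + ∑ m, ratFun c ε ρ (-v m) =
      -(w + ∑ m, v m) - c * ∑ j, ρ j * (1 / (ε j - w) + ∑ m, 1 / (ε j - v m)) := by
    simp only [ratFun, sum_sub_distrib, ← mul_sum, mul_add, sum_add_distrib, sum_neg_distrib,
      mul_one_div, ← sub_eq_add_neg]
    rw [Finset.sum_comm]
    simp only [div_eq_mul_inv, one_mul, mul_sum]
    ring
  rw [h3, sum_congr rfl fun j _ => h1 j, sum_add_distrib, hv.sum_eq, h2]
  ring

/-- The linear relation satisfied by the boundary values of the two-point function. -/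
theorem IsBoundaryMatrix.boundary_relation (H : IsBoundaryMatrix c ε ρ r hat K) {w : ℂ}
    (hw : ∀ j, ε j + w ≠ 0) (hwe : ∀ l, ratFun c ε ρ w ≠ ratFun c ε ρ (ε l))
    (hneg : ∀ k, ratFun c ε ρ (ε k) ≠ ratFun c ε ρ (-w)) :
    ratFun c ε ρ w + ratFun c ε ρ (-w) +
      c * ∑ k, r k / (ratFun c ε ρ (ε k) - ratFun c ε ρ w) +
      c * ∑ k, r k * boundaryTwoPoint c ε ρ r K k w = 0 := by
  obtain ⟨v, hv⟩ := exists_isFiber (c := c) (ρ := ρ) hw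
  rw [mul_sum univ (fun k => r k * boundaryTwoPoint c ε ρ r K k w),
    sum_congr rfl fun k _ => H.boundary_eq_nodeResidue hv hwe (hneg k), sum_neg_distrib,
    sum_nodeResidue H.nondeg.value_injective]
  have := hv.sum_ratFun_neg H.nondeg hwe
  simp only [← H.mult_eq] at this
  linear_combination this

/-- The two-point equation at generic points, for any function `G` with the given value
at `(z, w)`. -/
theorem IsBoundaryMatrix.generic_equation (H : IsBoundaryMatrix c ε ρ r hat K) {z w G : ℂ}
    (hz : ∀ j, ε j + z ≠ 0) (hze : ∀ l, ratFun c ε ρ z ≠ ratFun c ε ρ (ε l))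
    (hzneg : ∀ k, ratFun c ε ρ (ε k) ≠ ratFun c ε ρ (-z))
    (hw : ∀ j, ε j + w ≠ 0) (hwe : ∀ l, ratFun c ε ρ w ≠ ratFun c ε ρ (ε l))
    (hwneg : ∀ k, ratFun c ε ρ (ε k) ≠ ratFun c ε ρ (-w))
    (hzw : ratFun c ε ρ z - ratFun c ε ρ (-w) ≠ 0)
    (hG : (ratFun c ε ρ w - ratFun c ε ρ (-z)) * (ratFun c ε ρ z - ratFun c ε ρ (-w)) * G =
      ratFun c ε ρ z + ratFun c ε ρ w +
      c * ∑ k, (r k / (ratFun c ε ρ (ε k) - ratFun c ε ρ z) +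
        r k / (ratFun c ε ρ (ε k) - ratFun c ε ρ w)) +
      c ^ 2 * ∑ k, ∑ l, r k * r l * K k l /
        ((ratFun c ε ρ (ε k) - ratFun c ε ρ z) * (ratFun c ε ρ (ε l) - ratFun c ε ρ w))) :
    (ratFun c ε ρ z + ratFun c ε ρ w + c * ∑ k, r k * boundaryTwoPoint c ε ρ r K k z) * G =
      1 + c * ∑ k, r k * ((boundaryTwoPoint c ε ρ r K k w - G) /
        (ratFun c ε ρ (ε k) - ratFun c ε ρ z)) := by
  have hKz := H.boundary_relation hz hze hzneg
  have hKw := H.boundary_relation hw hwe hwneg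
  set a := ratFun c ε ρ z
  set b := ratFun c ε ρ w
  set q := ratFun c ε ρ (-w)
  set p := ratFun c ε ρ (-z)
  have h1 : ∀ k, (a - q) * (r k * (boundaryTwoPoint c ε ρ r K k w / (ratFun c ε ρ (ε k) - a))) =
      r k / (ratFun c ε ρ (ε k) - a) + c * ∑ l, r k * r l * K k l /
        ((ratFun c ε ρ (ε k) - a) * (ratFun c ε ρ (ε l) - b)) -
        r k * boundaryTwoPoint c ε ρ r K k w := by
    intro k
    have e1 : boundaryTwoPoint c ε ρ r K k w * (ratFun c ε ρ (ε k) - q) =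
        1 + c * ∑ l, r l * K k l / (ratFun c ε ρ (ε l) - b) :=
      div_mul_cancel₀ _ (sub_ne_zero.2 (hwneg k))
    have e2 : ∑ l, r k * r l * K k l / ((ratFun c ε ρ (ε k) - a) * (ratFun c ε ρ (ε l) - b)) =
        r k / (ratFun c ε ρ (ε k) - a) * ∑ l, r l * K k l / (ratFun c ε ρ (ε l) - b) := by
      rw [mul_sum]
      refine sum_congr rfl fun l _ => ?_
      rw [div_mul_div_comm, mul_assoc]
    rw [e2]
    have hka := sub_ne_zero.2 (hze k).symm
    field_simp
    linear_combination (r k) * e1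
  have h2 := sum_congr rfl fun k (_ : k ∈ univ) => h1 k
  rw [← mul_sum, sum_sub_distrib, sum_add_distrib, ← mul_sum] at h2
  have h3 : ∑ k, r k * ((boundaryTwoPoint c ε ρ r K k w - G) / (ratFun c ε ρ (ε k) - a)) =
      ∑ k, r k * (boundaryTwoPoint c ε ρ r K k w / (ratFun c ε ρ (ε k) - a)) -
        (∑ k, r k / (ratFun c ε ρ (ε k) - a)) * G := by
    rw [sum_mul, ← sum_sub_distrib]
    exact sum_congr rfl fun k _ => by ring
  rw [h3]
  rw [sum_add_distrib] at hG
  refine mul_left_cancel₀ hzw ?_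
  linear_combination (a - q) * G * hKz + hG - c * h2 + hKw

end TwoPoint

/-! ### A regular form of the two-point function -/

section Regularised
open Finset

variable {d : ℕ} {c : ℂ} {ε ρ r : Fin d → ℂ} {hat K : Fin d → Fin d → ℂ}

/-- The denominator `∏ j, (ε j - z)` of `R (-z)`. -/
noncomputable def poleProd {d : ℕ} (ε : Fin d → ℂ) (z : ℂ) : ℂ := ∏ j, (ε j - z)

/-- The polynomial function `poleProd ε z * R (-z)`. -/
noncomputable def clearedReflection {d : ℕ} (c : ℂ) (ε ρ : Fin d → ℂ) (z : ℂ) : ℂ :=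
  -z * poleProd ε z - c * ∑ j, ρ j * ∏ i ∈ Finset.univ.erase j, (ε i - z)

/-- The function `poleProd ε z / (R (ε k) - R z)`, regular at the points `ε l`. -/
noncomputable def clearedPole {d : ℕ} (ε : Fin d → ℂ) (hat : Fin d → Fin d → ℂ) (k : Fin d)
    (z : ℂ) : ℂ :=
  (∏ i ∈ Finset.univ.erase k, (ε i - z)) * (∏ j, (z + ε j)) / ∏ j, (z - hat k j)

/-- The two-point function with numerator and denominator multiplied by
`poleProd ε z * poleProd ε w`: this form is manifestly regular at the points `(ε k, ε l)`. -/
noncomputable def clearedTwoPoint {d : ℕ} (c : ℂ) (ε ρ r : Fin d → ℂ)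
    (hat K : Fin d → Fin d → ℂ) (p : ℂ × ℂ) : ℂ :=
  (poleProd ε p.1 * poleProd ε p.2 * (ratFun c ε ρ p.1 + ratFun c ε ρ p.2) +
    c * ∑ k, (r k * (clearedPole ε hat k p.1 * poleProd ε p.2) +
      r k * (poleProd ε p.1 * clearedPole ε hat k p.2)) +
    c ^ 2 * ∑ k, ∑ l, r k * r l * K k l * (clearedPole ε hat k p.1 * clearedPole ε hat l p.2)) /
  ((poleProd ε p.1 * ratFun c ε ρ p.2 - clearedReflection c ε ρ p.1) *
    (poleProd ε p.2 * ratFun c ε ρ p.1 - clearedReflection c ε ρ p.2))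

/-- The points off the poles of `R` and off the further preimages `hat k j`. -/
def regularPoints {d : ℕ} (ε : Fin d → ℂ) (hat : Fin d → Fin d → ℂ) : Set ℂ :=
  {z | (∀ j, ε j + z ≠ 0) ∧ ∀ k j, z - hat k j ≠ 0}

/-- The set on which `clearedTwoPoint` is an honest quotient of holomorphic functions. -/
def regularPairs {d : ℕ} (c : ℂ) (ε ρ : Fin d → ℂ) (hat : Fin d → Fin d → ℂ) : Set (ℂ × ℂ) :=
  {p | p.1 ∈ regularPoints ε hat ∧ p.2 ∈ regularPoints ε hat ∧
    poleProd ε p.1 * ratFun c ε ρ p.2 - clearedReflection c ε ρ p.1 ≠ 0 ∧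
    poleProd ε p.2 * ratFun c ε ρ p.1 - clearedReflection c ε ρ p.2 ≠ 0}

theorem poleProd_node (k : Fin d) : poleProd ε (ε k) = 0 :=
  prod_eq_zero (mem_univ k) (sub_self _)

theorem poleProd_ne_zero_iff {z : ℂ} : poleProd ε z ≠ 0 ↔ ∀ k, z ≠ ε k := by
  rw [poleProd, prod_ne_zero_iff]
  simp [sub_ne_zero, eq_comm]

theorem clearedReflection_node (k : Fin d) :
    clearedReflection c ε ρ (ε k) = -(c * ρ k * ∏ i ∈ univ.erase k, (ε i - ε k)) := by
  rw [clearedReflection, poleProd_node, sum_eq_single k]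
  · ring
  · intro j _ hj
    rw [prod_eq_zero (i := k) (mem_erase.2 ⟨hj.symm, mem_univ _⟩) (sub_self _), mul_zero]
  · simp

theorem clearedReflection_eq {z : ℂ} (hz : ∀ k, z ≠ ε k) :
    clearedReflection c ε ρ z = poleProd ε z * ratFun c ε ρ (-z) := by
  rw [clearedReflection, ratFun, mul_sub, mul_left_comm, mul_sum univ _ (poleProd ε z)]
  congr 1
  · ring
  · congr 1
    refine sum_congr rfl fun j _ => ?_
    rw [poleProd, ← mul_prod_erase univ _ (mem_univ j)]
    have := sub_ne_zero.2 (hz j).symm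
    rw [← sub_eq_add_neg]
    field_simp

theorem clearedPole_node_of_ne {k l : Fin d} (hkl : k ≠ l) : clearedPole ε hat k (ε l) = 0 := by
  rw [clearedPole, prod_eq_zero (i := l) (mem_erase.2 ⟨hkl.symm, mem_univ _⟩) (sub_self _)]
  simp

theorem IsFiber.clearedPole_node {k : Fin d} (h : IsFiber c ε ρ (ε k) (hat k))
    (hε : ∀ j, ε j + ε k ≠ 0) (hs : ratSlope c ε ρ (ε k) ≠ 0) :
    clearedPole ε hat k (ε k) * ratSlope c ε ρ (ε k) = ∏ i ∈ univ.erase k, (ε i - ε k) := by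
  rw [clearedPole, ← h.slope_mul_prod hε]
  have : ∏ j, (ε k + ε j) ≠ 0 :=
    prod_ne_zero_iff.2 fun j _ => by rw [add_comm]; exact hε j
  field_simp

theorem IsFiber.value_ne {k : Fin d} {v : Fin d → ℂ} (h : IsFiber c ε ρ (ε k) v) {z : ℂ}
    (hz : ∀ j, ε j + z ≠ 0) (hzk : z ≠ ε k) (hzv : ∀ j, z - v j ≠ 0) :
    ratFun c ε ρ z ≠ ratFun c ε ρ (ε k) := by
  intro hR
  rcases h.eq_or_exists hz hR with h | ⟨m, h⟩
  · exact hzk h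
  · exact hzv m (sub_eq_zero.2 h.symm)

theorem IsFiber.clearedPole_eq {k : Fin d} (h : IsFiber c ε ρ (ε k) (hat k)) {z : ℂ}
    (hz : ∀ j, ε j + z ≠ 0) (hzk : z ≠ ε k) (hzv : ∀ j, z - hat k j ≠ 0) :
    clearedPole ε hat k z = poleProd ε z / (ratFun c ε ρ (ε k) - ratFun c ε ρ z) := by
  rw [eq_div_iff (sub_ne_zero.2 (h.value_ne hz hzk hzv).symm), clearedPole, div_mul_eq_mul_div,
    div_eq_iff (prod_ne_zero_iff.2 fun j _ => hzv j), poleProd,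
    ← mul_prod_erase univ (fun j => ε j - z) (mem_univ k)]
  linear_combination (-∏ i ∈ univ.erase k, (ε i - z)) * h.sub_mul_prod hz

theorem clearedTwoPoint_symm (hK : ∀ k l, K k l = K l k) (z w : ℂ) :
    clearedTwoPoint c ε ρ r hat K (z, w) = clearedTwoPoint c ε ρ r hat K (w, z) := by
  simp only [clearedTwoPoint]
  rw [Finset.sum_comm]
  congr 1
  · congr 1
    · congr 1
      · ring
      · congr 1
        exact sum_congr rfl fun k _ => by ring
    · congr 1
      exact sum_congr rfl fun k _ => sum_congr rfl fun l _ => by rw [hK]; ring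
  · ring

theorem regularPairs_symm {z w : ℂ} (h : (z, w) ∈ regularPairs c ε ρ hat) :
    (w, z) ∈ regularPairs c ε ρ hat :=
  ⟨h.2.1, h.1, h.2.2.2, h.2.2.1⟩

theorem differentiable_poleProd : Differentiable ℂ (poleProd ε) := by
  unfold poleProd; fun_prop

theorem differentiable_clearedReflection : Differentiable ℂ (clearedReflection c ε ρ) := by
  have := differentiable_poleProd (ε := ε)
  unfold clearedReflection; fun_prop

theorem differentiableAt_clearedPole {z : ℂ} (hz : z ∈ regularPoints ε hat) (k : Fin d) :
    DifferentiableAt ℂ (clearedPole ε hat k) z := by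
  unfold clearedPole
  exact DifferentiableAt.div (by fun_prop) (by fun_prop)
    (prod_ne_zero_iff.2 fun j _ => hz.2 k j)

theorem differentiableAt_clearedTwoPoint {p : ℂ × ℂ} (hp : p ∈ regularPairs c ε ρ hat) :
    DifferentiableAt ℂ (clearedTwoPoint c ε ρ r hat K) p := by
  obtain ⟨h1, h2, h3, h4⟩ := hp
  have a1 : DifferentiableAt ℂ (fun p : ℂ × ℂ => ratFun c ε ρ p.1) p :=
    DifferentiableAt.comp p (hasDerivAt_ratFun h1.1).differentiableAt differentiableAt_fst
  have a2 : DifferentiableAt ℂ (fun p : ℂ × ℂ => ratFun c ε ρ p.2) p :=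
    DifferentiableAt.comp p (hasDerivAt_ratFun h2.1).differentiableAt differentiableAt_snd
  have b1 : ∀ k, DifferentiableAt ℂ (fun p : ℂ × ℂ => clearedPole ε hat k p.1) p := fun k =>
    DifferentiableAt.comp p (differentiableAt_clearedPole h1 k) differentiableAt_fst
  have b2 : ∀ k, DifferentiableAt ℂ (fun p : ℂ × ℂ => clearedPole ε hat k p.2) p := fun k =>
    DifferentiableAt.comp p (differentiableAt_clearedPole h2 k) differentiableAt_snd
  have c1 : DifferentiableAt ℂ (fun p : ℂ × ℂ => poleProd ε p.1) p :=
    DifferentiableAt.comp (g := poleProd ε) p (differentiable_poleProd _) differentiableAt_fst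
  have c2 : DifferentiableAt ℂ (fun p : ℂ × ℂ => poleProd ε p.2) p :=
    DifferentiableAt.comp (g := poleProd ε) p (differentiable_poleProd _) differentiableAt_snd
  have d1 : DifferentiableAt ℂ (fun p : ℂ × ℂ => clearedReflection c ε ρ p.1) p :=
    DifferentiableAt.comp (g := clearedReflection c ε ρ) p (differentiable_clearedReflection _) differentiableAt_fst
  have d2 : DifferentiableAt ℂ (fun p : ℂ × ℂ => clearedReflection c ε ρ p.2) p :=
    DifferentiableAt.comp (g := clearedReflection c ε ρ) p (differentiable_clearedReflection _) differentiableAt_snd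
  unfold clearedTwoPoint
  simp only [div_eq_mul_inv]
  refine DifferentiableAt.fun_mul ?_ (DifferentiableAt.fun_inv ?_ (mul_ne_zero h3 h4))
  · refine DifferentiableAt.fun_add (DifferentiableAt.fun_add ?_ ?_) ?_
    · exact (c1.fun_mul c2).fun_mul (a1.fun_add a2)
    · exact (DifferentiableAt.fun_sum fun k _ => (((b1 k).fun_mul c2).const_mul (r k)).fun_add
        ((c1.fun_mul (b2 k)).const_mul (r k))).const_mul c
    · exact (DifferentiableAt.fun_sum fun k _ => DifferentiableAt.fun_sum fun l _ =>
        ((b1 k).fun_mul (b2 l)).const_mul (r k * r l * K k l)).const_mul (c ^ 2)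
  · exact ((c1.fun_mul a2).fun_sub d1).fun_mul ((c2.fun_mul a1).fun_sub d2)

theorem isOpen_regularPoints : IsOpen (regularPoints ε hat) := by
  simp only [regularPoints, Set.ofPred_and, Set.ofPred_forall]
  refine (isOpen_iInter_of_finite fun j => ?_).inter (isOpen_iInter_of_finite fun k =>
    isOpen_iInter_of_finite fun j => ?_)
  · exact isOpen_ne_fun (by fun_prop) (by fun_prop)
  · exact isOpen_ne_fun (by fun_prop) (by fun_prop)

theorem isOpen_regularPairs : IsOpen (regularPairs c ε ρ hat) := by
  rw [isOpen_iff_eventually]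
  rintro p ⟨h1, h2, h3, h4⟩
  have a1 : ContinuousAt (fun p : ℂ × ℂ => ratFun c ε ρ p.1) p :=
    ContinuousAt.comp (hasDerivAt_ratFun h1.1).continuousAt continuousAt_fst
  have a2 : ContinuousAt (fun p : ℂ × ℂ => ratFun c ε ρ p.2) p :=
    ContinuousAt.comp (hasDerivAt_ratFun h2.1).continuousAt continuousAt_snd
  have c1 := (differentiable_poleProd (ε := ε)).continuous
  have d1 := (differentiable_clearedReflection (c := c) (ε := ε) (ρ := ρ)).continuous
  have o := isOpen_regularPoints (ε := ε) (hat := hat)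
  filter_upwards [continuousAt_fst.preimage_mem_nhds (o.mem_nhds h1),
    continuousAt_snd.preimage_mem_nhds (o.mem_nhds h2),
    ContinuousAt.eventually_ne (g := fun p : ℂ × ℂ =>
      poleProd ε p.1 * ratFun c ε ρ p.2 - clearedReflection c ε ρ p.1) (by fun_prop) h3,
    ContinuousAt.eventually_ne (g := fun p : ℂ × ℂ =>
      poleProd ε p.2 * ratFun c ε ρ p.1 - clearedReflection c ε ρ p.2) (by fun_prop) h4]
    with q q1 q2 q3 q4 using ⟨q1, q2, q3, q4⟩

theorem IsNondegenerate.node_gap_ne (h : IsNondegenerate c ε ρ) (k : Fin d) :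
    ∏ i ∈ univ.erase k, (ε i - ε k) ≠ 0 :=
  prod_ne_zero_iff.2 fun _ hi => sub_ne_zero.2 (h.injective.ne (mem_erase.1 hi).1)

theorem IsBoundaryMatrix.node_mem_regularPoints (H : IsBoundaryMatrix c ε ρ r hat K) (k : Fin d) :
    ε k ∈ regularPoints ε hat :=
  ⟨fun j => H.nondeg.add_ne j k, fun m j =>
    sub_ne_zero.2 (H.nondeg.fiber_node_ne (H.fiber m) j k)⟩

theorem IsBoundaryMatrix.node_mem_regularPairs (H : IsBoundaryMatrix c ε ρ r hat K)
    (k l : Fin d) : (ε k, ε l) ∈ regularPairs c ε ρ hat := by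
  have : ∀ k, clearedReflection c ε ρ (ε k) ≠ 0 := fun k => by
    rw [clearedReflection_node]
    exact neg_ne_zero.2 (mul_ne_zero (mul_ne_zero H.nondeg.coupling_ne (H.nondeg.weight_ne k))
      (H.nondeg.node_gap_ne k))
  refine ⟨H.node_mem_regularPoints k, H.node_mem_regularPoints l, ?_, ?_⟩ <;>
  simpa [poleProd_node] using this _

theorem IsBoundaryMatrix.clearedPole_node (H : IsBoundaryMatrix c ε ρ r hat K) (k : Fin d) :
    c * (r k * clearedPole ε hat k (ε k)) = -clearedReflection c ε ρ (ε k) := by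
  rw [clearedReflection_node, H.mult_eq, neg_neg,
    ← (H.fiber k).clearedPole_node (H.nondeg.add_ne · k) (H.nondeg.slope_ne k)]
  ring

theorem IsBoundaryMatrix.clearedTwoPoint_node_left (H : IsBoundaryMatrix c ε ρ r hat K)
    (k : Fin d) (w : ℂ) :
    clearedTwoPoint c ε ρ r hat K (ε k, w) =
      (poleProd ε w + c * ∑ l, r l * K k l * clearedPole ε hat l w) /
        (poleProd ε w * ratFun c ε ρ (ε k) - clearedReflection c ε ρ w) := by
  have hn : -clearedReflection c ε ρ (ε k) ≠ 0 := by
    have := (H.node_mem_regularPairs k k).2.2.1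
    simpa [poleProd_node] using this
  simp only [clearedTwoPoint, poleProd_node, zero_mul, zero_sub, mul_zero, add_zero, zero_add]
  rw [sum_eq_single k (fun m _ hm => by rw [clearedPole_node_of_ne hm]; simp) (by simp),
    sum_eq_single k (fun m _ hm => by rw [clearedPole_node_of_ne hm]; simp) (by simp)]
  have h1 : ∑ l, r k * r l * K k l * (clearedPole ε hat k (ε k) * clearedPole ε hat l w) =
      (r k * clearedPole ε hat k (ε k)) * ∑ l, r l * K k l * clearedPole ε hat l w := by
    rw [mul_sum]
    exact sum_congr rfl fun l _ => by ring
  rw [h1, ← mul_div_mul_left _ (poleProd ε w * ratFun c ε ρ (ε k) - clearedReflection c ε ρ w) hn]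
  congr 1
  rw [← H.clearedPole_node k]
  ring

theorem IsBoundaryMatrix.clearedTwoPoint_node (H : IsBoundaryMatrix c ε ρ r hat K) (k l : Fin d) :
    clearedTwoPoint c ε ρ r hat K (ε k, ε l) = K k l := by
  have hn : -clearedReflection c ε ρ (ε l) ≠ 0 := by
    have := (H.node_mem_regularPairs l l).2.2.1
    simpa [poleProd_node] using this
  rw [H.clearedTwoPoint_node_left, poleProd_node,
    sum_eq_single l (fun m _ hm => by rw [clearedPole_node_of_ne hm]; simp) (by simp),
    zero_mul, zero_sub, zero_add, div_eq_iff hn, ← H.clearedPole_node l]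
  ring

theorem IsBoundaryMatrix.clearedTwoPoint_boundary (H : IsBoundaryMatrix c ε ρ r hat K)
    (k : Fin d) {w : ℂ} (hw : w ∈ regularPoints ε hat) (hwε : ∀ l, w ≠ ε l) :
    clearedTwoPoint c ε ρ r hat K (ε k, w) = boundaryTwoPoint c ε ρ r K k w := by
  have hD : poleProd ε w ≠ 0 := poleProd_ne_zero_iff.2 hwε
  rw [H.clearedTwoPoint_node_left, boundaryTwoPoint, clearedReflection_eq hwε, ← mul_sub,
    ← mul_div_mul_left _ (ratFun c ε ρ (ε k) - ratFun c ε ρ (-w)) hD]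
  congr 1
  rw [mul_add, mul_one, mul_left_comm, mul_sum univ _ (poleProd ε w)]
  congr 2
  refine sum_congr rfl fun l _ => ?_
  rw [(H.fiber l).clearedPole_eq hw.1 (hwε l) (hw.2 l)]
  ring

/-- Off the points `ε k` the cleared form satisfies the defining formula. -/
theorem IsBoundaryMatrix.clearedTwoPoint_formula (H : IsBoundaryMatrix c ε ρ r hat K)
    {z w : ℂ} (hzw : (z, w) ∈ regularPairs c ε ρ hat) (hz : ∀ l, z ≠ ε l) (hw : ∀ l, w ≠ ε l) :
    (ratFun c ε ρ w - ratFun c ε ρ (-z)) ≠ 0 ∧ (ratFun c ε ρ z - ratFun c ε ρ (-w)) ≠ 0 ∧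
    (ratFun c ε ρ w - ratFun c ε ρ (-z)) * (ratFun c ε ρ z - ratFun c ε ρ (-w)) *
      clearedTwoPoint c ε ρ r hat K (z, w) =
      ratFun c ε ρ z + ratFun c ε ρ w +
      c * ∑ k, (r k / (ratFun c ε ρ (ε k) - ratFun c ε ρ z) +
        r k / (ratFun c ε ρ (ε k) - ratFun c ε ρ w)) +
      c ^ 2 * ∑ k, ∑ l, r k * r l * K k l /
        ((ratFun c ε ρ (ε k) - ratFun c ε ρ z) * (ratFun c ε ρ (ε l) - ratFun c ε ρ w)) := by
  obtain ⟨h1, h2, h3, h4⟩ := hzw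
  simp only at h1 h2 h3 h4
  rw [clearedReflection_eq hz, ← mul_sub] at h3
  rw [clearedReflection_eq hw, ← mul_sub] at h4
  refine ⟨right_ne_zero_of_mul h3, right_ne_zero_of_mul h4, ?_⟩
  have hD := poleProd_ne_zero_iff.2 hz
  have hD' := poleProd_ne_zero_iff.2 hw
  have e1 : ∑ k, (r k * (clearedPole ε hat k z * poleProd ε w) +
      r k * (poleProd ε z * clearedPole ε hat k w)) = (poleProd ε z * poleProd ε w) *
      ∑ k, (r k / (ratFun c ε ρ (ε k) - ratFun c ε ρ z) +
        r k / (ratFun c ε ρ (ε k) - ratFun c ε ρ w)) := by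
    rw [mul_sum]
    refine sum_congr rfl fun k _ => ?_
    rw [(H.fiber k).clearedPole_eq h1.1 (hz k) (h1.2 k),
      (H.fiber k).clearedPole_eq h2.1 (hw k) (h2.2 k)]
    ring
  have e2 : ∑ k, ∑ l, r k * r l * K k l * (clearedPole ε hat k z * clearedPole ε hat l w) =
      (poleProd ε z * poleProd ε w) * ∑ k, ∑ l, r k * r l * K k l /
        ((ratFun c ε ρ (ε k) - ratFun c ε ρ z) * (ratFun c ε ρ (ε l) - ratFun c ε ρ w)) := by
    rw [mul_sum]
    refine sum_congr rfl fun k _ => ?_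
    rw [mul_sum]
    refine sum_congr rfl fun l _ => ?_
    rw [(H.fiber k).clearedPole_eq h1.1 (hz k) (h1.2 k),
      (H.fiber l).clearedPole_eq h2.1 (hw l) (h2.2 l), div_mul_div_comm]
    ring
  simp only [clearedTwoPoint]
  rw [clearedReflection_eq hz, clearedReflection_eq hw, ← mul_sub, ← mul_sub, e1, e2]
  rw [mul_div_assoc', div_eq_iff (mul_ne_zero h3 h4)]
  ring

/-- The two-point equation at generic points of a set of regular pairs. -/
theorem IsBoundaryMatrix.clearedTwoPoint_equation (H : IsBoundaryMatrix c ε ρ r hat K)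
    {z w : ℂ} (hzw : (z, w) ∈ regularPairs c ε ρ hat)
    (hzn : ∀ k, (z, ε k) ∈ regularPairs c ε ρ hat) (hwn : ∀ k, (w, ε k) ∈ regularPairs c ε ρ hat)
    (hz : ∀ l, z ≠ ε l) (hw : ∀ l, w ≠ ε l) :
    (ratFun c ε ρ z + ratFun c ε ρ w + c * ∑ k, r k * clearedTwoPoint c ε ρ r hat K (z, ε k)) *
      clearedTwoPoint c ε ρ r hat K (z, w) =
      1 + c * ∑ k, r k * ((clearedTwoPoint c ε ρ r hat K (ε k, w) -
        clearedTwoPoint c ε ρ r hat K (z, w)) / (ratFun c ε ρ (ε k) - ratFun c ε ρ z)) := by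
  obtain ⟨f1, f2, f3⟩ := H.clearedTwoPoint_formula hzw hz hw
  have hv : ∀ {y : ℂ}, y ∈ regularPoints ε hat → (∀ l, y ≠ ε l) →
      ∀ l, ratFun c ε ρ y ≠ ratFun c ε ρ (ε l) := fun hy hyl l =>
    (H.fiber l).value_ne hy.1 (hyl l) (hy.2 l)
  have hneg : ∀ {y : ℂ}, (∀ l, y ≠ ε l) → (∀ k, (y, ε k) ∈ regularPairs c ε ρ hat) →
      ∀ k, ratFun c ε ρ (ε k) ≠ ratFun c ε ρ (-y) := by
    intro y hyl hy k
    have := (hy k).2.2.1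
    simp only at this
    rw [clearedReflection_eq hyl, ← mul_sub] at this
    exact sub_ne_zero.1 (right_ne_zero_of_mul this)
  have := H.generic_equation hzw.1.1 (hv hzw.1 hz) (hneg hz hzn) hzw.2.1.1 (hv hzw.2.1 hw)
    (hneg hw hwn) f2 f3
  rw [sum_congr rfl fun k _ => by
    rw [clearedTwoPoint_symm H.symm z, H.clearedTwoPoint_boundary k hzw.1 hz], this]
  congr 2
  exact sum_congr rfl fun k _ => by rw [H.clearedTwoPoint_boundary k hzw.2.1 hw]

end Regularised

/-! ### Extension of the equation by continuity -/

section Extension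
open Finset

variable {N d : ℕ} {e : Fin d → ℝ} {r : Fin d → ℕ} {lam : ℂ}

/-- Functions that are continuous at `y` and agree near `y` off the finite set of the `e k` agree
at `y`, even if `y` is one of the `e k`. -/
theorem eq_of_generic {f g : ℂ → ℂ} {U : Set ℂ} {y : ℂ} (hU : U ∈ 𝓝 y) (hf : ContinuousAt f y)
    (hg : ContinuousAt g y) (e : Fin d → ℂ) (h : ∀ x ∈ U, (∀ k, x ≠ e k) → f x = g x) :
    f y = g y := by
  have hev : ∀ᶠ x in 𝓝[≠] y, f x = g x := by
    have h1 : ∀ k, ∀ᶠ x in 𝓝[≠] y, x ≠ e k := fun k => by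
      by_cases hk : y = e k
      · subst hk; exact self_mem_nhdsWithin
      · exact (continuousAt_id.eventually_ne hk).filter_mono nhdsWithin_le_nhds
    filter_upwards [nhdsWithin_le_nhds hU, eventually_all.2 h1] with x hx hx' using h x hx hx'
  exact tendsto_nhds_unique_of_eventuallyEq (hf.tendsto.mono_left nhdsWithin_le_nhds)
    (hg.tendsto.mono_left nhdsWithin_le_nhds) hev

/-- The extended two-point equation passes from generic to arbitrary arguments. The second
argument is treated first: the equation then only involves difference quotients. -/
theorem extendedTwoPointEq_of_generic {G : ℂ → ℂ → ℂ} {U : Set ℂ} (hU : IsOpen U)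
    (heU : ∀ k, (e k : ℂ) ∈ U)
    (hG : ∀ ζ ∈ U, ∀ η ∈ U, DifferentiableAt ℂ (fun p : ℂ × ℂ => G p.1 p.2) (ζ, η))
    (h : ∀ ζ ∈ U, ∀ η ∈ U, (∀ k, ζ ≠ e k) → (∀ k, η ≠ e k) →
      (ζ + η + lam / N * ∑ k, r k * G ζ (e k)) * G ζ η =
        1 + lam / N * ∑ k, r k * ((G (e k) η - G ζ η) / (e k - ζ)))
    {ζ η : ℂ} (hζ : ζ ∈ U) (hη : η ∈ U) : ExtendedTwoPointEq N e r lam G ζ η := by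
  have hG1 : ∀ ζ ∈ U, ∀ η ∈ U, DifferentiableAt ℂ (fun x => G x η) ζ := fun ζ hζ η hη =>
    (hG ζ hζ η hη).comp (f := fun x : ℂ => (x, η)) ζ (by fun_prop)
  have hG2 : ∀ ζ ∈ U, ∀ η ∈ U, DifferentiableAt ℂ (fun y => G ζ y) η := fun ζ hζ η hη =>
    (hG ζ hζ η hη).comp (f := fun y : ℂ => (ζ, y)) η (by fun_prop)
  have hslope : ∀ ζ ∈ U, ∀ η ∈ U, (∀ k, ζ ≠ e k) → ExtendedTwoPointEq N e r lam G ζ η := by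
    intro ζ hζ η hη hζe
    have hd : ∀ k, ∀ η, dslope (fun x => G x η) (e k : ℂ) ζ = (G (e k) η - G ζ η) / (e k - ζ) := by
      intro k η
      rw [dslope_of_ne _ (hζe k), slope_def_field, ← neg_sub (G ζ η), ← neg_sub ζ, neg_div_neg_eq]
    simp only [ExtendedTwoPointEq, hd]
    have c1 := (hG2 ζ hζ η hη).continuousAt
    have c2 := fun k => (hG2 _ (heU k) η hη).continuousAt
    refine eq_of_generic
      (f := fun η => (ζ + η + lam / N * ∑ k, r k * G ζ (e k)) * G ζ η)
      (g := fun η => 1 + lam / N * ∑ k, r k * ((G (e k) η - G ζ η) / (e k - ζ)))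
      (hU.mem_nhds hη) (by fun_prop) ?_ (fun k => (e k : ℂ)) (fun y hy hye => h ζ hζ y hy hζe hye)
    simp only [div_eq_mul_inv]
    fun_prop
  have c1 := (hG1 ζ hζ η hη).continuousAt
  have c2 := fun k => (hG1 ζ hζ _ (heU k)).continuousAt
  have c3 : ∀ k, ContinuousAt (dslope (fun x => G x η) (e k : ℂ)) ζ := by
    intro k
    by_cases hk : ζ = e k
    · rw [hk]
      exact continuousAt_dslope_same.2 (hG1 _ (heU k) η hη)
    · exact (continuousAt_dslope_of_ne hk).2 c1
  exact eq_of_generic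
      (f := fun ζ => (ζ + η + lam / N * ∑ k, r k * G ζ (e k)) * G ζ η)
      (g := fun ζ => 1 + lam / N * ∑ k, r k * dslope (fun x => G x η) (e k : ℂ) ζ)
      (hU.mem_nhds hζ) (by fun_prop) (by fun_prop) (fun k => (e k : ℂ))
      (fun x hx hxe => hslope x hx η hη hxe)

/-- A sum over the tuple `E` is a sum over its distinct entries with multiplicities. -/
theorem sum_tuple_eq {E : Fin N → ℝ} (he : Function.Injective e)
    (hrange : Set.range e = Set.range E) (hr : ∀ k, r k = multiplicityOf E (e k)) (f : ℝ → ℂ) :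
    ∑ a, f (E a) = ∑ k, r k * f (e k) := by
  choose idx hidx using fun a : Fin N => (hrange ▸ Set.mem_range_self a : E a ∈ Set.range e)
  have h1 : ∀ k, (univ.filter fun a => idx a = k) = univ.filter fun a => E a = e k := by
    intro k
    ext a
    simp only [mem_filter, mem_univ, true_and]
    constructor
    · rintro rfl; exact (hidx a).symm
    · intro h; exact he ((hidx a).trans h)
  rw [← sum_fiberwise univ idx]
  refine sum_congr rfl fun k _ => ?_
  rw [h1, sum_congr rfl (g := fun _ => f (e k)) fun a ha => by rw [(mem_filter.1 ha).2],
    sum_const, nsmul_eq_mul, hr, multiplicityOf]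

theorem twoPointEq_of_extended {E : Fin N → ℝ} (he : Function.Injective e)
    (hrange : Set.range e = Set.range E) (hr : ∀ k, r k = multiplicityOf E (e k)) {G : ℂ → ℂ → ℂ}
    (h : ∀ k l, ExtendedTwoPointEq N e r lam G (e k) (e l)) : TwoPointEq E lam G := by
  intro a b
  obtain ⟨k, hk⟩ : E a ∈ Set.range e := hrange ▸ Set.mem_range_self a
  obtain ⟨l, hl⟩ : E b ∈ Set.range e := hrange ▸ Set.mem_range_self b
  rw [sum_tuple_eq he hrange hr fun x => G (E a) x,
    sum_tuple_eq he hrange hr fun x => dslope (fun y => G y (E b)) (x : ℂ) (E a : ℂ), ← hk, ← hl]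
  exact h k l

end Extension

/-! ### Removable singularities -/

section Removable
open Finset

variable {N d : ℕ} {r : Fin d → ℕ} {lam : ℂ} {ε ρ : Fin d → ℂ} {hat : Fin d → Fin d → ℂ}

theorem IsBoundaryMatrix.mem_domG (H : IsBoundaryMatrix (lam / N) ε ρ (fun k => (r k : ℂ)) hat
    (constG N lam ε ρ hat)) {p : ℂ × ℂ} (hp : p ∈ regularPairs (lam / N) ε ρ hat)
    (h1 : ∀ l, p.1 ≠ ε l) (h2 : ∀ l, p.2 ≠ ε l) : p ∈ domG N lam ε ρ := by
  obtain ⟨f1, f2, -⟩ := H.clearedTwoPoint_formula hp h1 h2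
  refine ⟨fun k => ⟨hp.1.1 k, sub_ne_zero.2 (h1 k).symm, hp.2.1.1 k, sub_ne_zero.2 (h2 k).symm⟩,
    fun k => ⟨sub_ne_zero.2 ?_, sub_ne_zero.2 ?_⟩, f1, f2⟩
  · exact ((H.fiber k).value_ne hp.1.1 (h1 k) (hp.1.2 k)).symm
  · exact ((H.fiber k).value_ne hp.2.1.1 (h2 k) (hp.2.1.2 k)).symm

theorem IsBoundaryMatrix.exprG_eq (H : IsBoundaryMatrix (lam / N) ε ρ (fun k => (r k : ℂ)) hat
    (constG N lam ε ρ hat)) {p : ℂ × ℂ} (hp : p ∈ regularPairs (lam / N) ε ρ hat)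
    (h1 : ∀ l, p.1 ≠ ε l) (h2 : ∀ l, p.2 ≠ ε l) :
    exprG N r lam ε ρ hat p =
      clearedTwoPoint (lam / N) ε ρ (fun k => (r k : ℂ)) hat (constG N lam ε ρ hat) p := by
  obtain ⟨f1, f2, f3⟩ := H.clearedTwoPoint_formula hp h1 h2
  have : ratR N lam ε ρ = ratFun (lam / N) ε ρ := rfl
  simp only [exprG, this]
  rw [← div_pow, ← f3, one_div, inv_mul_cancel_left₀ (mul_ne_zero f1 f2)]

theorem IsBoundaryMatrix.tendsto_exprG (H : IsBoundaryMatrix (lam / N) ε ρ (fun k => (r k : ℂ)) hat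
    (constG N lam ε ρ hat)) {p : ℂ × ℂ} (hp : p ∈ regularPairs (lam / N) ε ρ hat) :
    Tendsto (exprG N r lam ε ρ hat) (𝓝[domG N lam ε ρ] p)
      (𝓝 (clearedTwoPoint (lam / N) ε ρ (fun k => (r k : ℂ)) hat (constG N lam ε ρ hat) p)) := by
  have hc := ((differentiableAt_clearedTwoPoint (r := fun k => (r k : ℂ))
    (K := constG N lam ε ρ hat) hp).continuousAt.tendsto).mono_left
    (nhdsWithin_le_nhds (s := domG N lam ε ρ))
  refine hc.congr' ?_
  filter_upwards [self_mem_nhdsWithin, nhdsWithin_le_nhds (isOpen_regularPairs.mem_nhds hp)]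
    with q hq hq'
  exact (H.exprG_eq hq' (fun l hl => (hq.1 l).2.1 (sub_eq_zero.2 hl.symm))
    (fun l hl => (hq.1 l).2.2.2 (sub_eq_zero.2 hl.symm))).symm

theorem IsBoundaryMatrix.mem_closure_domG (H : IsBoundaryMatrix (lam / N) ε ρ
    (fun k => (r k : ℂ)) hat (constG N lam ε ρ hat)) {p : ℂ × ℂ}
    (hp : p ∈ regularPairs (lam / N) ε ρ hat) : p ∈ closure (domG N lam ε ρ) := by
  have hd : Dense ((Set.range ε)ᶜ : Set ℂ) := ((Set.finite_range ε).countable).dense_compl ℂ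
  refine closure_mono ?_ ((hd.prod hd).open_subset_closure_inter isOpen_regularPairs hp)
  rintro q ⟨hq, h1, h2⟩
  exact H.mem_domG hq (fun l hl => h1 ⟨l, hl.symm⟩) (fun l hl => h2 ⟨l, hl.symm⟩)

theorem IsBoundaryMatrix.ratG_eq (H : IsBoundaryMatrix (lam / N) ε ρ (fun k => (r k : ℂ)) hat
    (constG N lam ε ρ hat)) {z w : ℂ} (hp : (z, w) ∈ regularPairs (lam / N) ε ρ hat) :
    ratG N r lam ε ρ hat z w =
      clearedTwoPoint (lam / N) ε ρ (fun k => (r k : ℂ)) hat (constG N lam ε ρ hat) (z, w) :=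
  extendFrom_eq (H.mem_closure_domG hp) (H.tendsto_exprG hp)

end Removable

/-! ### Branches of the inverse of `R` -/

section Branch

/-- A property holding near `a` holds on all sufficiently small balls about `a`, so that finitely
many such properties admit a common radius. -/
theorem eventually_ball_of_eventually {X : Type*} [PseudoMetricSpace X] {a : X} {P : X → Prop}
    (h : ∀ᶠ x in 𝓝 a, P x) : ∀ᶠ s in 𝓝[>] (0 : ℝ), ∀ x ∈ Metric.ball a s, P x := by
  obtain ⟨t, ht, hP⟩ := Metric.eventually_nhds_iff_ball.1 h
  filter_upwards [Ioo_mem_nhdsGT ht] with s hs x hx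
  exact hP x (Metric.ball_subset_ball hs.2.le hx)

variable {d : ℕ} {c : ℂ} {ε ρ : Fin d → ℂ}

theorem analyticAt_ratFun {z : ℂ} (hz : ∀ j, ε j + z ≠ 0) : AnalyticAt ℂ (ratFun c ε ρ) z := by
  unfold ratFun
  refine analyticAt_id.fun_sub (analyticAt_const.fun_mul
    (Finset.analyticAt_fun_sum _ fun j _ => ?_))
  exact analyticAt_const.fun_div (analyticAt_const.fun_add analyticAt_id) (hz j)

theorem exists_local_branch {u : ℂ} (hu : ∀ j, ε j + u ≠ 0) (hs : ratSlope c ε ρ u ≠ 0) :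
    ∃ g : ℂ → ℂ, g (ratFun c ε ρ u) = u ∧ ∀ᶠ ζ in 𝓝 (ratFun c ε ρ u),
      DifferentiableAt ℂ g ζ ∧ ratFun c ε ρ (g ζ) = ζ := by
  have ha := analyticAt_ratFun (c := c) (ρ := ρ) hu
  have hd : deriv (ratFun c ε ρ) u ≠ 0 := by rwa [(hasDerivAt_ratFun hu).deriv]
  refine ⟨ha.hasStrictDerivAt.localInverse _ _ _ hd, ?_, ?_⟩
  · exact HasStrictFDerivAt.localInverse_apply_image ..
  · exact ((ha.analyticAt_localInverse hd).eventually_analyticAt.mono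
      fun _ h => h.differentiableAt).and (HasStrictDerivAt.eventually_right_inverse ..)

/-- A branch of `R⁻¹` on a union of disjoint discs about the values `R (ε k)`, whose values lie
pairwise in a prescribed open set containing all `(ε k, ε l)`. -/
theorem IsNondegenerate.exists_branch (h : IsNondegenerate c ε ρ) {Ω : Set (ℂ × ℂ)}
    (hΩ : IsOpen Ω) (hεΩ : ∀ k l, (ε k, ε l) ∈ Ω) :
    ∃ s > 0, ∃ g : ℂ → ℂ, (∀ k, g (ratFun c ε ρ (ε k)) = ε k) ∧
      (∀ ζ ∈ ⋃ k, Metric.ball (ratFun c ε ρ (ε k)) s,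
        DifferentiableAt ℂ g ζ ∧ ratFun c ε ρ (g ζ) = ζ) ∧
      ∀ ζ ∈ ⋃ k, Metric.ball (ratFun c ε ρ (ε k)) s,
        ∀ η ∈ ⋃ k, Metric.ball (ratFun c ε ρ (ε k)) s, (g ζ, g η) ∈ Ω := by
  classical
  choose b hb hbev using fun k => exists_local_branch (c := c) (ρ := ρ) (h.add_ne · k)
    (h.slope_ne k)
  have hΩev : ∀ k l, ∀ᶠ p : ℂ × ℂ in 𝓝 (ratFun c ε ρ (ε k), ratFun c ε ρ (ε l)),
      (b k p.1, b l p.2) ∈ Ω := by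
    intro k l
    have hck := (hbev k).self_of_nhds.1.continuousAt
    have hcl := (hbev l).self_of_nhds.1.continuousAt
    have hcont : ContinuousAt (fun p : ℂ × ℂ => (b k p.1, b l p.2))
        (ratFun c ε ρ (ε k), ratFun c ε ρ (ε l)) :=
      (ContinuousAt.comp (f := Prod.fst) (g := b k) hck continuousAt_fst).prodMk
        (ContinuousAt.comp (f := Prod.snd) (g := b l) hcl continuousAt_snd)
    exact hcont.preimage_mem_nhds (hΩ.mem_nhds (by simpa [hb] using hεΩ k l))
  have hsep : ∀ k l, k ≠ l → ∀ᶠ s in 𝓝[>] (0 : ℝ),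
      Disjoint (Metric.ball (ratFun c ε ρ (ε k)) s) (Metric.ball (ratFun c ε ρ (ε l)) s) := by
    intro k l hkl
    have hpos : 0 < dist (ratFun c ε ρ (ε k)) (ratFun c ε ρ (ε l)) :=
      dist_pos.2 (h.value_injective.ne hkl)
    filter_upwards [Ioo_mem_nhdsGT (half_pos hpos)] with s hs
    exact Metric.ball_disjoint_ball (by linarith [hs.2])
  obtain ⟨s, ⟨⟨hs1, hs2⟩, hs3⟩, hs⟩ :=
    ((((eventually_all.2 fun k => eventually_ball_of_eventually (hbev k)).and
      (eventually_all.2 fun k => eventually_all.2 fun l =>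
        eventually_ball_of_eventually (hΩev k l))).and
      (eventually_all.2 fun k => eventually_all.2 fun l => eventually_all.2 (hsep k l))).and
      self_mem_nhdsWithin).exists
  have hs : 0 < s := hs
  let g : ℂ → ℂ := fun ζ =>
    if hζ : ∃ k, ζ ∈ Metric.ball (ratFun c ε ρ (ε k)) s then b hζ.choose ζ else 0
  have hg : ∀ k, ∀ ζ ∈ Metric.ball (ratFun c ε ρ (ε k)) s, g ζ = b k ζ := by
    intro k ζ hζ
    have hex : ∃ k, ζ ∈ Metric.ball (ratFun c ε ρ (ε k)) s := ⟨k, hζ⟩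
    have hk : hex.choose = k := by
      by_contra hne
      exact Set.disjoint_left.1 (hs3 _ _ hne) hex.choose_spec hζ
    simp only [g, dif_pos hex, hk]
  refine ⟨s, hs, g, fun k => ?_, fun ζ hζ => ?_, fun ζ hζ η hη => ?_⟩
  · rw [hg k _ (Metric.mem_ball_self hs), hb]
  · obtain ⟨k, hk⟩ := Set.mem_iUnion.1 hζ
    refine ⟨(hs1 k ζ hk).1.congr_of_eventuallyEq ?_, by rw [hg k ζ hk]; exact (hs1 k ζ hk).2⟩
    filter_upwards [Metric.isOpen_ball.mem_nhds hk] with y hy using hg k y hy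
  · obtain ⟨k, hk⟩ := Set.mem_iUnion.1 hζ
    obtain ⟨l, hl⟩ := Set.mem_iUnion.1 hη
    rw [hg k ζ hk, hg l η hl]
    exact hs2 k l (ζ, η) (by rw [← ball_prod_same]; exact ⟨hk, hl⟩)

end Branch

/-! ### The two-point function of a solution with unramified fibres -/

section Solution
open Finset

variable {N d : ℕ} {e : Fin d → ℝ} {r : Fin d → ℕ} {lam : ℂ} {ε ρ : Fin d → ℂ}

/-- The fibres of `R` over the values `R (ε k)` are unramified. -/
def HasSimpleFibers {d : ℕ} (c : ℂ) (ε ρ : Fin d → ℂ) : Prop :=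
  ∀ k z, (∀ j, ε j + z ≠ 0) → ratFun c ε ρ z = ratFun c ε ρ (ε k) → ratSlope c ε ρ z ≠ 0

theorem SolvesSystem.value_eq (hs : SolvesSystem N e r lam ε ρ) (k : Fin d) :
    ratFun (lam / N) ε ρ (ε k) = e k := (hs.2.1 k).symm

theorem SolvesSystem.mult_eq (hs : SolvesSystem N e r lam ε ρ) (k : Fin d) :
    (r k : ℂ) = ρ k * ratSlope (lam / N) ε ρ (ε k) := by
  rw [hs.2.2 k, ← (hasDerivAt_ratFun (hs.1 · k)).deriv]
  rfl

theorem SolvesSystem.isNondegenerate (hs : SolvesSystem N e r lam ε ρ)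
    (he : Function.Injective e) (hr : ∀ k, r k ≠ 0) (hlam : lam / N ≠ 0) :
    IsNondegenerate (lam / N) ε ρ := by
  have hne : ∀ k, ρ k * ratSlope (lam / N) ε ρ (ε k) ≠ 0 := fun k => by
    rw [← hs.mult_eq]; exact Nat.cast_ne_zero.2 (hr k)
  refine ⟨hlam, fun k => left_ne_zero_of_mul (hne k), hs.1, fun k l hkl => he ?_,
    fun k => right_ne_zero_of_mul (hne k)⟩
  simp only [hs.value_eq] at hkl
  exact_mod_cast hkl

open Polynomial in
theorem IsFiber.injective_of_simple {c w : ℂ} {v : Fin d → ℂ} (h : IsFiber c ε ρ w v)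
    (hc : c ≠ 0) (hρ : ∀ k, ρ k ≠ 0) (hε : Function.Injective ε)
    (hsimple : ∀ z, (∀ j, ε j + z ≠ 0) → ratFun c ε ρ z = ratFun c ε ρ w →
      ratSlope c ε ρ z ≠ 0) : Function.Injective v := by
  intro i j hij
  by_contra hne
  obtain ⟨h1, h2⟩ := h.mem hc hρ hε i
  have h3 := eval_derivative_fiberPoly h1 h2
  have h4 : (derivative (∏ m, (X - C (v m)) : ℂ[X])).eval (v i) = 0 := by
    rw [← mul_prod_erase univ _ (mem_univ i),
      ← mul_prod_erase (univ.erase i) _ (mem_erase.2 ⟨Ne.symm hne, mem_univ j⟩), hij]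
    simp
  have h5 : (∏ m, (X - C (v m)) : ℂ[X]).eval (v i) = 0 := by
    rw [eval_prod, prod_eq_zero (mem_univ i) (by simp)]
  rw [h, derivative_mul, eval_add, eval_mul, eval_mul, h4, h5, mul_zero, mul_zero, add_zero] at h3
  exact mul_ne_zero (hsimple _ h1 h2)
    (prod_ne_zero_iff.2 fun j _ => by rw [add_comm]; exact h1 j) h3.symm

theorem IsNondegenerate.listsOtherRoots (h : IsNondegenerate (lam / N) ε ρ)
    (hsimple : HasSimpleFibers (lam / N) ε ρ) {k : Fin d} {v : Fin d → ℂ}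
    (hv : IsFiber (lam / N) ε ρ (ε k) v) : ListsOtherRoots N lam ε ρ (ε k) v := by
  refine ⟨hv.injective_of_simple h.coupling_ne h.weight_ne h.injective (hsimple k),
    fun z => ⟨?_, fun ⟨h1, h2, h3⟩ => (hv.eq_or_exists h2 h3).resolve_left h1⟩⟩
  rintro ⟨j, rfl⟩
  exact ⟨(h.fiber_node_ne hv j k).symm, hv.mem h.coupling_ne h.weight_ne h.injective j⟩

theorem SolvesSystem.isBoundaryMatrix (hs : SolvesSystem N e r lam ε ρ)
    (h : IsNondegenerate (lam / N) ε ρ) {hat : Fin d → Fin d → ℂ}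
    (hhat : ∀ k, IsFiber (lam / N) ε ρ (ε k) (hat k)) :
    IsBoundaryMatrix (lam / N) ε ρ (fun k => (r k : ℂ)) hat (constG N lam ε ρ hat) := by
  refine ⟨h, hs.mult_eq, hhat, fun k l => ?_, fun k l => ?_⟩
  · rw [← h.residue_eq (hhat k) (hhat l), ← hs.mult_eq,
      ← (hasDerivAt_ratFun (hs.1 · k)).deriv, ← (hasDerivAt_ratFun (hs.1 · l)).deriv]
    rfl
  · simp only [constG]
    rw [Finset.prod_comm]
    congr 1
    · rw [mul_right_comm]
      congr 2
      exact prod_congr rfl fun i _ => prod_congr rfl fun j _ => by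
        rw [add_comm (ε j), sub_eq_add_neg, sub_eq_add_neg, add_comm (-hat k j)]
    · rw [add_comm, mul_comm (deriv _ _)]

/-- All assertions about the two-point function, for a solution with unramified fibres. -/
theorem SolvesSystem.exists_twoPoint {E : Fin N → ℝ} (hs : SolvesSystem N e r lam ε ρ)
    (he : Function.Injective e) (hrange : Set.range e = Set.range E)
    (hr : ∀ k, r k = multiplicityOf E (e k)) (hr0 : ∀ k, r k ≠ 0) (hlam : lam / N ≠ 0)
    (hsimple : HasSimpleFibers (lam / N) ε ρ) :
    ∃ hat : Fin d → Fin d → ℂ,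
      (∀ k, ListsOtherRoots N lam ε ρ (ε k) (hat k)) ∧
      (∀ k l, ratG N r lam ε ρ hat (ε k) (ε l) = constG N lam ε ρ hat k l) ∧
      ∃ (U : Fin d → Set ℂ) (Rinv : ℂ → ℂ),
        (∀ k, IsOpen (U k) ∧ IsConnected (U k) ∧ (e k : ℂ) ∈ U k) ∧
        DifferentiableOn ℂ Rinv (⋃ k, U k) ∧
        (∀ ζ ∈ ⋃ k, U k,
          (∀ k, ε k + Rinv ζ ≠ 0) ∧ ratR N lam ε ρ (Rinv ζ) = ζ) ∧
        (∀ k, Rinv (e k) = ε k) ∧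
        (∀ ζ ∈ ⋃ k, U k, ∀ η ∈ ⋃ k, U k,
          Tendsto (exprG N r lam ε ρ hat) (𝓝[domG N lam ε ρ] (Rinv ζ, Rinv η))
            (𝓝 (ratG N r lam ε ρ hat (Rinv ζ) (Rinv η)))) ∧
        DifferentiableOn ℂ
          (fun p : ℂ × ℂ => ratG N r lam ε ρ hat (Rinv p.1) (Rinv p.2))
          ((⋃ k, U k) ×ˢ (⋃ k, U k)) ∧
        (∀ ζ ∈ ⋃ k, U k, ∀ η ∈ ⋃ k, U k,
          ExtendedTwoPointEq N e r lam
            (fun ζ' η' => ratG N r lam ε ρ hat (Rinv ζ') (Rinv η')) ζ η) ∧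
        TwoPointEq E lam
          (fun ζ' η' => ratG N r lam ε ρ hat (Rinv ζ') (Rinv η')) := by
  have h := hs.isNondegenerate he hr0 hlam
  choose hat hhat using fun k => exists_isFiber (c := lam / N) (ρ := ρ) (h.add_ne · k)
  have H := hs.isBoundaryMatrix h hhat
  refine ⟨hat, fun k => h.listsOtherRoots hsimple (hhat k), fun k l => ?_, ?_⟩
  · rw [H.ratG_eq (H.node_mem_regularPairs k l), H.clearedTwoPoint_node]
  obtain ⟨s, hs0, g, hg, hgU, hgΩ⟩ := h.exists_branch isOpen_regularPairs H.node_mem_regularPairs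
  simp only [hs.value_eq] at hg hgU hgΩ
  set U : Fin d → Set ℂ := fun k => Metric.ball (e k : ℂ) s with hU
  have hUo : IsOpen (⋃ k, U k) := isOpen_iUnion fun k => Metric.isOpen_ball
  have heU : ∀ k, (e k : ℂ) ∈ ⋃ k, U k := fun k =>
    Set.mem_iUnion.2 ⟨k, Metric.mem_ball_self hs0⟩
  have hdiff : ∀ ζ ∈ ⋃ k, U k, ∀ η ∈ ⋃ k, U k, DifferentiableAt ℂ
      (fun p : ℂ × ℂ => ratG N r lam ε ρ hat (g p.1) (g p.2)) (ζ, η) := by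
    intro ζ hζ η hη
    have h1 : DifferentiableAt ℂ (fun p : ℂ × ℂ => (g p.1, g p.2)) (ζ, η) :=
      (DifferentiableAt.comp (f := Prod.fst) (g := g) _ (hgU ζ hζ).1 differentiableAt_fst).prodMk
        (DifferentiableAt.comp (f := Prod.snd) (g := g) _ (hgU η hη).1 differentiableAt_snd)
    have h2 := (differentiableAt_clearedTwoPoint (r := fun k => (r k : ℂ))
      (K := constG N lam ε ρ hat) (hgΩ ζ hζ η hη)).comp (f := fun p : ℂ × ℂ => (g p.1, g p.2))
        (ζ, η) h1
    refine h2.congr_of_eventuallyEq ?_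
    filter_upwards [(hUo.prod hUo).mem_nhds ⟨hζ, hη⟩] with p hp
    exact H.ratG_eq (hgΩ _ hp.1 _ hp.2)
  have hext : ∀ ζ ∈ ⋃ k, U k, ∀ η ∈ ⋃ k, U k, ExtendedTwoPointEq N e r lam
      (fun ζ' η' => ratG N r lam ε ρ hat (g ζ') (g η')) ζ η := by
    intro ζ hζ η hη
    refine extendedTwoPointEq_of_generic hUo heU hdiff ?_ hζ hη
    intro ζ hζ η hη hζe hηe
    have hne : ∀ x ∈ ⋃ k, U k, (∀ k, x ≠ e k) → ∀ l, g x ≠ ε l := by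
      intro x hx hxe l hl
      have := (hgU x hx).2
      rw [hl, hs.value_eq] at this
      exact hxe l this.symm
    have hnode : ∀ x ∈ ⋃ k, U k, ∀ k, (g x, ε k) ∈ regularPairs (lam / N) ε ρ hat := by
      intro x hx k
      have := hgΩ x hx (e k) (heU k)
      rwa [hg] at this
    have := H.clearedTwoPoint_equation (hgΩ ζ hζ η hη) (hnode ζ hζ) (hnode η hη)
      (hne ζ hζ hζe) (hne η hη hηe)
    rw [(hgU ζ hζ).2, (hgU η hη).2] at this
    simp only [hs.value_eq] at this
    simp only [hg]
    rw [H.ratG_eq (hgΩ ζ hζ η hη), sum_congr rfl fun k _ => by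
      rw [H.ratG_eq (hnode ζ hζ k)], this]
    congr 2
    exact sum_congr rfl fun k _ => by rw [H.ratG_eq (regularPairs_symm (hnode η hη k))]
  refine ⟨U, g, fun k => ⟨Metric.isOpen_ball, ?_, Metric.mem_ball_self hs0⟩,
    fun ζ hζ => (hgU ζ hζ).1.differentiableWithinAt,
    fun ζ hζ => ⟨(hgΩ ζ hζ ζ hζ).1.1, (hgU ζ hζ).2⟩, hg, fun ζ hζ η hη => ?_,
    fun p hp => (hdiff p.1 hp.1 p.2 hp.2).differentiableWithinAt, hext,
    twoPointEq_of_extended he hrange hr fun k l => hext _ (heU k) _ (heU l)⟩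
  · exact (convex_ball _ _).isConnected ⟨_, Metric.mem_ball_self hs0⟩
  · rw [H.ratG_eq (hgΩ ζ hζ η hη)]
    exact H.tendsto_exprG (hgΩ ζ hζ η hη)

end Solution

/-! ### Simplicity of the roots -/

section SimpleFibers
open Finset

variable {d : ℕ}

/-- For a positive coupling constant, all roots of `R z = R (ε k)` are real, and the slope of `R`
on the real axis is positive. -/
theorem hasSimpleFibers_of_pos {c : ℝ} (hc : 0 < c) {x y : Fin d → ℝ} (hy : ∀ k, 0 < y k) :
    HasSimpleFibers (c : ℂ) (fun k => (x k : ℂ)) fun k => (y k : ℂ) := by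
  intro k z hz hzk
  have hz' : ∀ j, 0 < Complex.normSq (x j + z) := fun j => Complex.normSq_pos.2 (hz j)
  have him := congrArg Complex.im hzk
  have hR : (ratFun (c : ℂ) (fun k => (x k : ℂ)) (fun k => (y k : ℂ)) (x k)).im = 0 := by
    have : ratFun (c : ℂ) (fun k => (x k : ℂ)) (fun k => (y k : ℂ)) (x k) =
        ((x k - c * ∑ j, y j / (x j + x k) : ℝ) : ℂ) := by
      simp [ratFun]
    rw [this, Complex.ofReal_im]
  rw [hR, ratFun, Complex.sub_im, Complex.im_ofReal_mul, Complex.im_sum] at him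
  have hterm : ∀ j, ((y j : ℂ) / (x j + z)).im =
      -(y j / Complex.normSq (x j + z) * z.im) := by
    intro j
    rw [div_eq_mul_inv, Complex.im_ofReal_mul, Complex.inv_im]
    simp only [Complex.add_im, Complex.ofReal_im, zero_add]
    ring
  rw [sum_congr rfl fun j _ => hterm j, sum_neg_distrib, ← sum_mul] at him
  have hS : 0 ≤ c * ∑ j, y j / Complex.normSq (x j + z) :=
    mul_nonneg hc.le (sum_nonneg fun j _ => (div_pos (hy j) (hz' j)).le)
  have hz0 : z.im = 0 := by
    have : z.im * (1 + c * ∑ j, y j / Complex.normSq (x j + z)) = 0 := by linear_combination him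
    exact (mul_eq_zero.1 this).resolve_right (by positivity)
  obtain ⟨t, rfl⟩ : ∃ t : ℝ, z = t := ⟨z.re, by apply Complex.ext <;> simp [hz0]⟩
  have : ratSlope (c : ℂ) (fun k => (x k : ℂ)) (fun k => (y k : ℂ)) t =
      ((1 + c * ∑ j, y j / (x j + t) ^ 2 : ℝ) : ℂ) := by
    simp [ratSlope]
  rw [this, Complex.ofReal_ne_zero]
  have : 0 ≤ c * ∑ j, y j / (x j + t) ^ 2 :=
    mul_nonneg hc.le (sum_nonneg fun j _ => div_nonneg (hy j).le (sq_nonneg _))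
  positivity

/-- For a small coupling constant a critical point of `R` lies close to one pole `-ε m`, and the
value of `R` there is close to `-ε m` as well; this value cannot be `R (ε k)`. -/
theorem hasSimpleFibers_of_small {c : ℂ} {ε ρ : Fin d → ℂ} {γ B : ℝ} (hγ : 0 < γ)
    (hgap : ∀ i j, i ≠ j → γ ≤ ‖ε i - ε j‖)
    (hadd : ∀ j k, γ ≤ ‖ε j + ratFun c ε ρ (ε k)‖) (hρ : ∀ j, ‖ρ j‖ ≤ B)
    (hc : ‖c‖ * (d * B) ≤ γ ^ 2 / 20) : HasSimpleFibers c ε ρ := by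
  intro k z hz hzk hslope
  have hz' : ∀ j, 0 < ‖ε j + z‖ := fun j => norm_pos_iff.2 (hz j)
  have hB : 0 ≤ B := (norm_nonneg _).trans (hρ k)
  have hbound : ∀ (s : Finset (Fin d)) (τ : ℝ) (n : ℕ), 0 < τ → (∀ j ∈ s, τ ≤ ‖ε j + z‖) →
      ‖c * ∑ j ∈ s, ρ j / (ε j + z) ^ n‖ ≤ ‖c‖ * (d * B) / τ ^ n := by
    intro s τ n hτ hs
    rw [norm_mul, mul_div_assoc]
    refine mul_le_mul_of_nonneg_left ((norm_sum_le _ _).trans ?_) (norm_nonneg c)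
    have : ∀ j ∈ s, ‖ρ j / (ε j + z) ^ n‖ ≤ B / τ ^ n := by
      intro j hj
      rw [norm_div, norm_pow]
      exact div_le_div₀ hB (hρ j) (pow_pos hτ n) (pow_le_pow_left₀ hτ.le (hs j hj) n)
    refine (sum_le_card_nsmul s _ _ this).trans ?_
    rw [nsmul_eq_mul, mul_div_assoc]
    refine mul_le_mul_of_nonneg_right ?_ (by positivity)
    exact_mod_cast (card_le_univ s).trans_eq (Fintype.card_fin d)
  by_cases hfar : ∀ j, γ / 4 ≤ ‖ε j + z‖
  · have h1 := hbound univ (γ / 4) 2 (by positivity) fun j _ => hfar j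
    have h2 : c * ∑ j, ρ j / (ε j + z) ^ 2 = -1 := by
      rw [ratSlope] at hslope; linear_combination hslope
    rw [h2, norm_neg, norm_one, le_div_iff₀ (by positivity)] at h1
    nlinarith [sq_nonneg γ, pow_pos hγ 2]
  · push Not at hfar
    obtain ⟨m, hm⟩ := hfar
    have hother : ∀ j ∈ univ.erase m, γ / 2 ≤ ‖ε j + z‖ := by
      intro j hj
      have h1 := hgap j m (mem_erase.1 hj).1
      have h2 := norm_sub_le (ε j + z) (ε m + z)
      rw [add_sub_add_right_eq_sub] at h2
      linarith
    have h1 := hbound _ (γ / 2) 1 (by positivity) hother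
    have h2 := hbound _ (γ / 2) 2 (by positivity) hother
    simp only [pow_one] at h1
    set a := c * ∑ j ∈ univ.erase m, ρ j / (ε j + z) with ha
    set b := c * ∑ j ∈ univ.erase m, ρ j / (ε j + z) ^ 2 with hb
    have e1 : ratFun c ε ρ (ε k) = z - c * (ρ m / (ε m + z)) - a := by
      rw [← hzk, ratFun, ← add_sum_erase univ _ (mem_univ m), ha]; ring
    have e2 : 1 + c * (ρ m / (ε m + z) ^ 2) + b = 0 := by
      rw [← hslope, ratSlope, ← add_sum_erase univ _ (mem_univ m), hb]; ring
    -- the polar term is eliminated by means of the vanishing slope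
    have e3 : ε m + ratFun c ε ρ (ε k) = (ε m + z) * (2 + b) - a := by
      have h3 : c * (ρ m / (ε m + z)) = (ε m + z) * (c * (ρ m / (ε m + z) ^ 2)) := by
        have := hz m
        field_simp
      rw [e1, h3]
      linear_combination (-(ε m + z)) * e2
    have h4 := hadd m k
    rw [e3] at h4
    have h5 : ‖a‖ ≤ γ / 10 := h1.trans (by
      rw [div_le_iff₀ (by positivity)]; nlinarith)
    have h6 : ‖b‖ ≤ 1 / 5 := h2.trans (by
      rw [div_le_iff₀ (by positivity)]; nlinarith)
    have h7 : ‖(ε m + z) * (2 + b)‖ ≤ γ / 4 * (2 + 1 / 5) := by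
      rw [norm_mul]
      refine mul_le_mul hm.le ((norm_add_le _ _).trans ?_) (norm_nonneg _) (by positivity)
      simpa using h6
    have h8 := norm_sub_le ((ε m + z) * (2 + b)) a
    linarith

end SimpleFibers

/-! ### Holomorphic solutions of `x = x₀ + t • Φ x` -/

section FixedPoint

/-- Holomorphic dependence and local uniqueness of the solution of `x = x₀ + t • Φ x` near
`t = 0`: the local inverse of `(t, x) ↦ (t, x - t • Φ x)` is evaluated at `(t, x₀)`. -/
theorem exists_holomorphic_fixedPoint {V : Type*} [NormedAddCommGroup V] [NormedSpace ℂ V]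
    [CompleteSpace V] {Φ : V → V} {x₀ : V} (hΦ : ContDiffAt ℂ 1 Φ x₀) :
    ∃ f : ℂ → V, f 0 = x₀ ∧ (∀ᶠ t in 𝓝 0, DifferentiableAt ℂ f t) ∧
      ∀ᶠ p : ℂ × V in 𝓝 (0, x₀), p.2 = x₀ + p.1 • Φ p.2 ↔ p.2 = f p.1 := by
  let Ψ : ℂ × V → ℂ × V := fun p => (p.1, p.2 - p.1 • Φ p.2)
  have hΦ2 : ContDiffAt ℂ 1 (fun p : ℂ × V => Φ p.2) (0, x₀) :=
    ContDiffAt.comp (f := Prod.snd) (g := Φ) (0, x₀) hΦ contDiffAt_snd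
  have hΨ : ContDiffAt ℂ 1 Ψ (0, x₀) :=
    contDiffAt_fst.prodMk (contDiffAt_snd.sub (contDiffAt_fst.smul hΦ2))
  let L : (ℂ × V) ≃L[ℂ] (ℂ × V) :=
    ContinuousLinearEquiv.equivOfInverse
      ((ContinuousLinearMap.fst ℂ ℂ V).prod (ContinuousLinearMap.snd ℂ ℂ V -
        (ContinuousLinearMap.fst ℂ ℂ V).smulRight (Φ x₀)))
      ((ContinuousLinearMap.fst ℂ ℂ V).prod (ContinuousLinearMap.snd ℂ ℂ V +
        (ContinuousLinearMap.fst ℂ ℂ V).smulRight (Φ x₀)))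
      (fun p => by simp) (fun p => by simp)
  have hL : HasFDerivAt Ψ (L : (ℂ × V) →L[ℂ] (ℂ × V)) (0, x₀) := by
    have h1 : HasFDerivAt (fun p : ℂ × V => p.1 • Φ p.2) _ (0, x₀) :=
      hasFDerivAt_fst.smul (hΦ2.differentiableAt one_ne_zero).hasFDerivAt
    have h2 : HasFDerivAt Ψ _ (0, x₀) := hasFDerivAt_fst.prodMk (hasFDerivAt_snd.sub h1)
    refine h2.congr_fderiv ?_
    ext p <;> simp [L]
  have hΨ0 : Ψ (0, x₀) = (0, x₀) := by simp [Ψ]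
  have hstr := hΨ.hasStrictFDerivAt' hL one_ne_zero
  set I := hΨ.localInverse hL one_ne_zero with hI
  have hI0 : I (0, x₀) = (0, x₀) := by
    have := hΨ.localInverse_apply_image hL one_ne_zero
    rwa [hΨ0] at this
  have hleft : ∀ᶠ p in 𝓝 (0, x₀), I (Ψ p) = p := hstr.eventually_left_inverse
  have hright : ∀ᶠ p in 𝓝 ((0 : ℂ), x₀), Ψ (I p) = p := by
    have := hstr.eventually_right_inverse
    rwa [hΨ0] at this
  have hdiff : ∀ᶠ p in 𝓝 ((0 : ℂ), x₀), DifferentiableAt ℂ I p := by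
    have := (hΨ.to_localInverse hL one_ne_zero).eventually (by simp)
    rw [hΨ0] at this
    exact this.mono fun p hp => hp.differentiableAt one_ne_zero
  have hslice : Tendsto (fun t : ℂ => (t, x₀)) (𝓝 0) (𝓝 (0, x₀)) :=
    (continuous_id.prodMk continuous_const).tendsto 0
  refine ⟨fun t => (I (t, x₀)).2, by simp [hI0], ?_, ?_⟩
  · filter_upwards [hslice.eventually hdiff] with t ht
    exact (ht.comp (f := fun t : ℂ => (t, x₀)) t (by fun_prop)).snd
  · have hr' : ∀ᶠ p : ℂ × V in 𝓝 (0, x₀), Ψ (I (p.1, x₀)) = (p.1, x₀) :=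
      (hslice.comp (continuousAt_fst (p := ((0 : ℂ), x₀)))).eventually hright
    filter_upwards [hleft, hr'] with p hp hp'
    constructor
    · intro h
      have : Ψ p = (p.1, x₀) := by
        simp only [Ψ]
        rw [sub_eq_of_eq_add h]
      rw [this] at hp
      rw [hp]
    · intro h
      have h1 := congrArg Prod.fst hp'
      have h2 := congrArg Prod.snd hp'
      simp only [Ψ] at h1 h2
      rw [h1, ← h] at h2
      exact sub_eq_iff_eq_add.1 h2

end FixedPoint

/-! ### The implicitly defined solution -/

section Implicit
open Finset

variable {N d : ℕ} {e : Fin d → ℝ} {r : Fin d → ℕ}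

/-- The system in the form `x = x₀ + λ • Φ x`, for `x = (ε, ρ)`: the map `Φ`. -/
noncomputable def systemMap (N : ℕ) {d : ℕ} (x : (Fin d → ℂ) × (Fin d → ℂ)) :
    (Fin d → ℂ) × (Fin d → ℂ) :=
  (fun k => (N : ℂ)⁻¹ * ∑ j, x.2 j / (x.1 j + x.1 k),
    fun k => -((N : ℂ)⁻¹ * (x.2 k * ∑ j, x.2 j / (x.1 j + x.1 k) ^ 2)))

/-- The solution `(e, r)` of the system at `λ = 0`. -/
def freeSolution {d : ℕ} (e : Fin d → ℝ) (r : Fin d → ℕ) : (Fin d → ℂ) × (Fin d → ℂ) :=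
  (fun k => (e k : ℂ), fun k => (r k : ℂ))

theorem solvesSystem_iff {lam : ℂ} {x : (Fin d → ℂ) × (Fin d → ℂ)}
    (hx : ∀ k l, x.1 k + x.1 l ≠ 0) :
    SolvesSystem N e r lam x.1 x.2 ↔ x = freeSolution e r + lam • systemMap N x := by
  have hder : ∀ k, deriv (ratR N lam x.1 x.2) (x.1 k) = ratSlope (lam / N) x.1 x.2 (x.1 k) :=
    fun k => (hasDerivAt_ratFun (hx · k)).deriv
  simp only [SolvesSystem, hder, Prod.ext_iff, funext_iff]
  simp only [freeSolution, systemMap, ratR, ratSlope, Prod.fst_add, Prod.snd_add, Prod.smul_fst,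
    Prod.smul_snd, Pi.add_apply, Pi.smul_apply, smul_eq_mul]
  constructor
  · rintro ⟨-, h1, h2⟩
    exact ⟨fun k => by rw [h1 k]; ring, fun k => by rw [h2 k]; ring⟩
  · rintro ⟨h1, h2⟩
    exact ⟨hx, fun k => by linear_combination -h1 k, fun k => by linear_combination -h2 k⟩

theorem contDiffAt_systemMap {x : (Fin d → ℂ) × (Fin d → ℂ)} (hx : ∀ k l, x.1 k + x.1 l ≠ 0) :
    ContDiffAt ℂ 1 (systemMap N) x := by
  have h1 : ∀ k, ContDiffAt ℂ 1 (fun x : (Fin d → ℂ) × (Fin d → ℂ) => x.1 k) x := fun k => by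
    fun_prop
  have h2 : ∀ k, ContDiffAt ℂ 1 (fun x : (Fin d → ℂ) × (Fin d → ℂ) => x.2 k) x := fun k => by
    fun_prop
  refine ContDiffAt.prodMk (contDiffAt_pi.2 fun k => ?_) (contDiffAt_pi.2 fun k => ?_)
  · exact contDiffAt_const.mul (ContDiffAt.sum fun j _ => (h2 j).div ((h1 j).add (h1 k)) (hx j k))
  · exact (contDiffAt_const.mul ((h2 k).mul (ContDiffAt.sum fun j _ =>
      (h2 j).div (((h1 j).add (h1 k)).pow 2) (pow_ne_zero 2 (hx j k))))).neg

theorem systemMap_star (x : (Fin d → ℂ) × (Fin d → ℂ)) :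
    systemMap N (star x) = star (systemMap N x) := by
  apply Prod.ext <;> funext k <;>
  simp [systemMap, star_sum]

theorem freeSolution_star : star (freeSolution e r) = freeSolution e r := by
  apply Prod.ext <;> funext k <;> simp [freeSolution]

theorem eq_ofReal_of_star_eq {z : ℂ} (h : star z = z) : z = (z.re : ℂ) :=
  (Complex.conj_eq_iff_re.1 h).symm

theorem exists_implicitSolution (hpos : ∀ k, 0 < e k) (he : Function.Injective e)
    (hr : ∀ k, r k ≠ 0) :
    ∃ εf ρf : ℂ → Fin d → ℂ, ∃ δ > 0, IsImplicitSolution N e r δ εf ρf ∧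
      ∀ lam ∈ Metric.ball (0 : ℂ) δ, HasSimpleFibers (lam / N) (εf lam) (ρf lam) := by
  have hadd0 : ∀ k l, (freeSolution e r).1 k + (freeSolution e r).1 l ≠ 0 := fun k l => by
    have : (0 : ℝ) < e k + e l := add_pos (hpos k) (hpos l)
    simp only [freeSolution]
    exact_mod_cast this.ne'
  obtain ⟨f, hf0, hfd, hfiff⟩ := exists_holomorphic_fixedPoint (contDiffAt_systemMap (N := N) hadd0)
  have hfc : ContinuousAt f 0 := hfd.self_of_nhds.continuousAt
  have hft : Tendsto f (𝓝 0) (𝓝 (freeSolution e r)) := hf0 ▸ hfc.tendsto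
  -- the neighbourhood of `(e, r)` is a ball, hence invariant under complex conjugation
  have hnear : ∀ᶠ p : ℂ × ((Fin d → ℂ) × (Fin d → ℂ)) in 𝓝 (0, freeSolution e r),
      (p.2 = freeSolution e r + p.1 • systemMap N p.2 ↔ p.2 = f p.1) ∧
      (∀ k l, p.2.1 k + p.2.1 l ≠ 0) ∧ (∀ k, 0 < (p.2.1 k).re ∧ 0 < (p.2.2 k).re) := by
    refine hfiff.and (Eventually.and ?_ ?_)
    · refine eventually_all.2 fun k => eventually_all.2 fun l => ?_
      exact ContinuousAt.eventually_ne (g := fun p : ℂ × ((Fin d → ℂ) × (Fin d → ℂ)) =>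
        p.2.1 k + p.2.1 l) (by fun_prop) (hadd0 k l)
    · refine eventually_all.2 fun k => Eventually.and ?_ ?_
      · refine ContinuousAt.eventually_lt (f := fun _ => (0 : ℝ))
          (g := fun p : ℂ × ((Fin d → ℂ) × (Fin d → ℂ)) => (p.2.1 k).re)
          continuousAt_const (by fun_prop) ?_
        simpa [freeSolution] using hpos k
      · refine ContinuousAt.eventually_lt (f := fun _ => (0 : ℝ))
          (g := fun p : ℂ × ((Fin d → ℂ) × (Fin d → ℂ)) => (p.2.2 k).re)
          continuousAt_const (by fun_prop) ?_
        simpa [freeSolution] using Nat.pos_of_ne_zero (hr k)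
  obtain ⟨κ, hκ, hκp⟩ := Metric.eventually_nhds_iff_ball.1 hnear
  have hsmall : ∀ᶠ t : ℂ in 𝓝 0, f t ∈ Metric.ball (freeSolution e r) κ :=
    hft.eventually (Metric.ball_mem_nhds _ hκ)
  -- the constants of the estimate excluding multiple roots
  have hγ : ∀ᶠ γ in 𝓝[>] (0 : ℝ), (∀ i j, i ≠ j → γ < ‖(e i : ℂ) - e j‖) ∧
      ∀ j k, γ < ‖(e j : ℂ) + e k‖ := by
    refine Eventually.and (eventually_all.2 fun i => eventually_all.2 fun j =>
      eventually_all.2 fun hij => ?_) (eventually_all.2 fun j => eventually_all.2 fun k => ?_)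
    · have : 0 < ‖(e i : ℂ) - e j‖ :=
        norm_pos_iff.2 (sub_ne_zero.2 fun h => hij (he (by exact_mod_cast h)))
      exact nhdsWithin_le_nhds (Iio_mem_nhds this)
    · exact nhdsWithin_le_nhds (Iio_mem_nhds (norm_pos_iff.2 (hadd0 j k)))
  obtain ⟨γ, ⟨hγ1, hγ2⟩, hγ0⟩ := (hγ.and self_mem_nhdsWithin).exists
  have hγ0 : 0 < γ := hγ0
  have hfε : ∀ k, Tendsto (fun t => (f t).1 k) (𝓝 0) (𝓝 (e k)) := fun k =>
    (((continuous_apply k).comp continuous_fst).tendsto (freeSolution e r)).comp hft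
  have hfρ : ∀ k, Tendsto (fun t => (f t).2 k) (𝓝 0) (𝓝 (r k)) := fun k =>
    (((continuous_apply k).comp continuous_snd).tendsto (freeSolution e r)).comp hft
  set B : ℝ := ∑ k, (r k : ℝ) + 1 with hB
  have hest : ∀ᶠ t : ℂ in 𝓝 0, (∀ i j, i ≠ j → γ < ‖(f t).1 i - (f t).1 j‖) ∧
      (∀ j k, γ < ‖(f t).1 j + e k‖) ∧ (∀ j, ‖(f t).2 j‖ < B) ∧
      ‖t / N‖ * (d * B) < γ ^ 2 / 20 := by
    refine Eventually.and (eventually_all.2 fun i => eventually_all.2 fun j =>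
      eventually_all.2 fun hij => ?_) (Eventually.and (eventually_all.2 fun j =>
      eventually_all.2 fun k => ?_) (Eventually.and (eventually_all.2 fun j => ?_) ?_))
    · exact ((hfε i).sub (hfε j)).norm.eventually (lt_mem_nhds (hγ1 i j hij))
    · exact ((hfε j).add_const _).norm.eventually (lt_mem_nhds (hγ2 j k))
    · refine (hfρ j).norm.eventually (gt_mem_nhds ?_)
      rw [Complex.norm_natCast]
      have := single_le_sum (f := fun k => (r k : ℝ)) (fun k _ => Nat.cast_nonneg _) (mem_univ j)
      linarith
    · refine ContinuousAt.eventually_lt (f := fun t : ℂ => ‖t / N‖ * (d * B))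
        (g := fun _ => γ ^ 2 / 20) (by fun_prop) continuousAt_const ?_
      simp only [zero_div, norm_zero, zero_mul]
      positivity
  obtain ⟨δ', hδ', hδp⟩ := Metric.eventually_nhds_iff_ball.1 (hfd.and (hsmall.and hest))
  have hball : ∀ t ∈ Metric.ball (0 : ℂ) (min κ δ'), ∀ x ∈ Metric.ball (freeSolution e r) κ,
      (t, x) ∈ Metric.ball ((0 : ℂ), freeSolution e r) κ := by
    intro t ht x hx
    rw [← ball_prod_same]
    exact ⟨Metric.ball_subset_ball (min_le_left _ _) ht, hx⟩
  have hδ : ∀ t ∈ Metric.ball (0 : ℂ) (min κ δ'), t ∈ Metric.ball (0 : ℂ) δ' := fun t ht =>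
    Metric.ball_subset_ball (min_le_right _ _) ht
  have hsol : ∀ t ∈ Metric.ball (0 : ℂ) (min κ δ'), SolvesSystem N e r t (f t).1 (f t).2 := by
    intro t ht
    have h1 := hκp _ (hball t ht _ (hδp t (hδ t ht)).2.1)
    exact (solvesSystem_iff h1.2.1).2 (h1.1.2 rfl)
  refine ⟨fun t => (f t).1, fun t => (f t).2, min κ δ', lt_min hκ hδ', ⟨?_, ?_, ?_, ?_, hsol, ?_,
    ?_⟩, ?_⟩
  · exact fun t ht => (hδp t (hδ t ht)).1.fst.differentiableWithinAt
  · exact fun t ht => (hδp t (hδ t ht)).1.snd.differentiableWithinAt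
  · exact (continuous_fst.tendsto (freeSolution e r)).comp hft
  · exact (continuous_snd.tendsto (freeSolution e r)).comp hft
  · refine ⟨Metric.ball (freeSolution e r) κ, Metric.ball_mem_nhds _ hκ, fun t ht =>
      ⟨(hδp t (hδ t ht)).2.1, fun ε ρ hW hs => ?_⟩⟩
    have h1 := hκp _ (hball t ht _ hW)
    have h2 := h1.1.1 ((solvesSystem_iff (x := (ε, ρ)) h1.2.1).1 hs)
    exact Prod.ext_iff.1 h2
  · intro t ht k
    have htb : (t : ℂ) ∈ Metric.ball (0 : ℂ) (min κ δ') := by simpa using ht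
    have hW := (hδp t (hδ t htb)).2.1
    have h1 := hκp _ (hball t htb _ hW)
    have hWs : star (f t) ∈ Metric.ball (freeSolution e r) κ := by
      rw [mem_ball_iff_norm] at hW ⊢
      rwa [← freeSolution_star, ← star_sub, norm_star]
    have h2 := hκp _ (hball t htb _ hWs)
    have h3 : star (f t) = f t := by
      refine h2.1.1 ?_
      have h4 := congrArg star (h1.1.2 rfl)
      simp only [star_add, star_smul, freeSolution_star, ← systemMap_star] at h4
      simpa using h4
    have h5 : star ((f t).1 k) = (f t).1 k := congrFun (congrArg Prod.fst h3) k
    have h6 : star ((f t).2 k) = (f t).2 k := congrFun (congrArg Prod.snd h3) k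
    exact ⟨_, _, (h1.2.2 k).1, (h1.2.2 k).2, eq_ofReal_of_star_eq h5, eq_ofReal_of_star_eq h6⟩
  · intro t ht
    obtain ⟨h1, h2, h3, h4⟩ := (hδp t (hδ t ht)).2.2
    refine hasSimpleFibers_of_small hγ0 (fun i j hij => (h1 i j hij).le) (fun j k => ?_)
      (fun j => (h3 j).le) h4.le
    rw [(hsol t ht).value_eq]
    exact (h2 j k).le

end Implicit

theorem theorem1 {N d : ℕ} (E : Fin N → ℝ) (hE : ∀ a, 0 < E a)
    (e : Fin d → ℝ) (he : Function.Injective e) (hrange : Set.range e = Set.range E)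
    (r : Fin d → ℕ) (hr : ∀ k, r k = multiplicityOf E (e k)) :
    ∃ δ : ℝ, 0 < δ ∧ ∃ εf ρf : ℂ → Fin d → ℂ, IsImplicitSolution N e r δ εf ρf ∧
      ∀ (lam : ℂ) (ε ρ : Fin d → ℂ),
        ((lam ≠ 0 ∧ ‖lam‖ < δ ∧ ε = εf lam ∧ ρ = ρf lam) ∨
          (SolvesSystem N e r lam ε ρ ∧ (∃ t : ℝ, 0 < t ∧ lam = t) ∧
            ∀ k, ∃ x y : ℝ, 0 < x ∧ 0 < y ∧ ε k = x ∧ ρ k = y)) →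
        ∃ hat : Fin d → Fin d → ℂ,
          (∀ k, ListsOtherRoots N lam ε ρ (ε k) (hat k)) ∧
          (∀ k l, ratG N r lam ε ρ hat (ε k) (ε l) = constG N lam ε ρ hat k l) ∧
          ∃ (U : Fin d → Set ℂ) (Rinv : ℂ → ℂ),
            (∀ k, IsOpen (U k) ∧ IsConnected (U k) ∧ (e k : ℂ) ∈ U k) ∧
            DifferentiableOn ℂ Rinv (⋃ k, U k) ∧
            (∀ ζ ∈ ⋃ k, U k,
              (∀ k, ε k + Rinv ζ ≠ 0) ∧ ratR N lam ε ρ (Rinv ζ) = ζ) ∧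
            (∀ k, Rinv (e k) = ε k) ∧
            (∀ ζ ∈ ⋃ k, U k, ∀ η ∈ ⋃ k, U k,
              Tendsto (exprG N r lam ε ρ hat) (𝓝[domG N lam ε ρ] (Rinv ζ, Rinv η))
                (𝓝 (ratG N r lam ε ρ hat (Rinv ζ) (Rinv η)))) ∧
            DifferentiableOn ℂ
              (fun p : ℂ × ℂ => ratG N r lam ε ρ hat (Rinv p.1) (Rinv p.2))
              ((⋃ k, U k) ×ˢ (⋃ k, U k)) ∧
            (∀ ζ ∈ ⋃ k, U k, ∀ η ∈ ⋃ k, U k,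
              ExtendedTwoPointEq N e r lam
                (fun ζ' η' => ratG N r lam ε ρ hat (Rinv ζ') (Rinv η')) ζ η) ∧
            TwoPointEq E lam
              (fun ζ' η' => ratG N r lam ε ρ hat (Rinv ζ') (Rinv η')) := by
  have hr0 : ∀ k, r k ≠ 0 := by
    intro k
    obtain ⟨a, ha⟩ : e k ∈ Set.range E := hrange ▸ Set.mem_range_self k
    rw [hr, multiplicityOf]
    exact Finset.card_ne_zero_of_mem (Finset.mem_filter.2 ⟨Finset.mem_univ a, ha⟩)
  have hpos : ∀ k, 0 < e k := by
    intro k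
    obtain ⟨a, ha⟩ : e k ∈ Set.range E := hrange ▸ Set.mem_range_self k
    exact ha ▸ hE a
  obtain ⟨εf, ρf, δ, hδ, himp, hsimple⟩ := exists_implicitSolution (N := N) hpos he hr0
  refine ⟨δ, hδ, εf, ρf, himp, fun lam ε ρ h => ?_⟩
  rcases Nat.eq_zero_or_pos d with rfl | hd
  -- for the empty tuple `λ / N` is `0`, but all assertions are vacuous
  · have hN : IsEmpty (Fin N) := by
      rw [Set.range_eq_empty, eq_comm, Set.range_eq_empty_iff] at hrange
      exact hrange
    refine ⟨fun k => k.elim0, fun k => k.elim0, fun k => k.elim0, fun k => k.elim0, id,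
      fun k => k.elim0, ?_, ?_, fun k => k.elim0, ?_, ?_, ?_, fun a => isEmptyElim a⟩ <;>
    simp [DifferentiableOn]
  have hN : (N : ℂ) ≠ 0 := by
    obtain ⟨a, -⟩ : e ⟨0, hd⟩ ∈ Set.range E := hrange ▸ Set.mem_range_self _
    exact Nat.cast_ne_zero.2 a.pos.ne'
  rcases h with ⟨hlam, hsmall, rfl, rfl⟩ | ⟨hs, ⟨t, ht, rfl⟩, hreal⟩
  · have hmem : lam ∈ Metric.ball (0 : ℂ) δ := by simpa using hsmall
    exact (himp.2.2.2.2.1 lam hmem).exists_twoPoint he hrange hr hr0 (div_ne_zero hlam hN)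
      (hsimple lam hmem)
  · choose x y _ hy hx hy' using hreal
    refine hs.exists_twoPoint he hrange hr hr0
      (div_ne_zero (Complex.ofReal_ne_zero.2 ht.ne') hN) ?_
    obtain rfl : ε = fun k => (x k : ℂ) := funext hx
    obtain rfl : ρ = fun k => (y k : ℂ) := funext hy'
    have hNpos : (0 : ℝ) < N := by
      exact_mod_cast Nat.pos_of_ne_zero (by exact_mod_cast hN)
    have := hasSimpleFibers_of_pos (div_pos ht hNpos) (x := x) hy
    push_cast at this
    exact this
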